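/- Let $p$ be a prime and let $G$ be a pro-$p$ group with (finite) generator rank $d$. For a pro-$p$ group $H$ let $\mathbb F_p[[H]]=\varprojlim_U \mathbb F_p[H/U]$ be its completed group algebra, $I_H$ its augmentation ideal (with $I_H^m=\mathbb F_p[[H]]$ for $m\le 0$), and $H_n=\{h\in H : h-1\in I_H^n\}$ its Zassenhaus filtration. Write $I=I_G$ and $c_n=\dim_{\mathbb F_p}\mathbb F_p[[G]]/I^n$ (so $c_n=0$ for $n\le 0$). Let $1\to R\to F\xrightarrow{\ \phi\ }G\to 1$ be a presentation with $F$ a free pro-$p$ group on $d$ generators, let $\sigma_1,\dots,\sigma_d\in F$ be lifts of a minimal (topological) generating set of $G$, and put $x_j=\sigma_j-1\in\mathbb F_p[[F]]$. For every $k\ge 1$ let $\rho_{k,1},\dots,\rho_{k,r_k}\in R\cap F_k$ be chosen so that for every $n\ge 1$ the elements $\rho_{k,i}$ with $k\le n$ form a minimal system of generators of $RF_{n+1}/F_{n+1}$ as a normal subgroup of $F/F_{n+1}$. Put $f_{k,i}=\rho_{k,i}-1\in\mathbb F_p[[F]]$ and $r_0=1$. Then: (a) each $f_{k,i}$ has level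 exactly $v(f_{k,i})=k$, i.e. $f_{k,i}\in I_F^{k}\setminus I_F^{k+1}$; it can be written uniquely as $f_{k,i}=\sum_{j=1}^d \frac{\partial f_{k,i}}{\partial x_j}\,x_j$ with Fox derivatives $\frac{\partial f_{k,i}}{\partial x_j}\in\mathbb F_p[[F]]$; and for every $n\ge 1$ the non-commutative Jacobian induces a well-defined map of left $\mathbb F_p[[G]]$-modules $$J_n:\bigoplus_{k,i}\mathbb F_p[[G]]/I^{\,n-v(f_{k,i})}\longrightarrow\bigoplus_{j=1}^d\mathbb F_p[[G]]/I^{\,n-1},\qquad (g_{k,i})\longmapsto\Bigl(\sum_{k,i}g_{k,i}\,\phi\bigl(\tfrac{\partial f_{k,i}}{\partial x_j}\bigr)\Bigr)_{j};$$ (b) all $c_n$, and all $e_n=\dim_{\mathbb F_p}\ker J_n$ for $n\ge1$, are finite, and for all $n\ge 1$ $$\sum_{i=0}^n r_i\,c_{n-i}-d\,c_{n-1}=1+e_n .$$ -/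

import Mathlib

universe u v w

namespace GolodShafarevich

open scoped DirectSum

noncomputable section

/-! ### Pro-`p` groups and free pro-`p` groups -/

/-- A topological group is a pro-`p` group if it is profinite (compact, Hausdorff, totally
disconnected) and its quotient by every open normal subgroup is a `p`-group. -/
class IsProP (p : ℕ) (G : Type u) [Group G] [TopologicalSpace G] : Prop extends
    IsTopologicalGroup G, CompactSpace G, T2Space G, TotallyDisconnectedSpace G where
  isPGroup_quotient : ∀ U : OpenNormalSubgroup G, IsPGroup p (G ⧸ U.toSubgroup)

/-- The pro-`p` group `F` is free pro-`p` with basis `τ` (a finite family): every map from the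
index set to a pro-`p` group extends uniquely to a continuous homomorphism on `F`. -/
def IsFreeProPOn (p : ℕ) {F : Type u} [Group F] [TopologicalSpace F] [IsProP p F] {X : Type v}
    [Finite X] (τ : X → F) : Prop :=
  ∀ (H : Type u) [Group H] [TopologicalSpace H] [IsProP p H] (f : X → H),
    ∃! θ : F →ₜ* H, ∀ x, θ (τ x) = f x

/-- A family generates `G` topologically: the subgroup it generates is dense. -/
def TopGenerates {G : Type u} [Group G] [TopologicalSpace G] {X : Type v} (s : X → G) : Prop :=
  Dense (Subgroup.closure (Set.range s) : Set G)

/-- `s₁, …, s_d` is a minimal generating set of `G`: it generates `G` topologically, and `G` has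
no topological generating family with fewer elements. So `d` is the generator rank of `G`. -/
def IsMinimalGenerating {G : Type u} [Group G] [TopologicalSpace G] {d : ℕ} (s : Fin d → G) :
    Prop :=
  TopGenerates s ∧ ∀ (m : ℕ) (t : Fin m → G), TopGenerates t → d ≤ m

/-! ### The completed group algebra -/

section CompletedGroupAlgebra

variable (k : Type w) [CommRing k]

/-- The transition map `k[G/U] → k[G/V]` for open normal subgroups `U ≤ V`. -/
def transition {G : Type u} [Group G] [TopologicalSpace G] {U V : OpenNormalSubgroup G}
    (h : U ≤ V) :
    MonoidAlgebra k (G ⧸ U.toSubgroup) →ₐ[k] MonoidAlgebra k (G ⧸ V.toSubgroup) :=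
  MonoidAlgebra.mapDomainAlgHom k k
    (QuotientGroup.map U.toSubgroup V.toSubgroup (MonoidHom.id G) (fun _ hx => h hx))

/-- The inverse limit of the group algebras `k[G/U]`, inside their product. -/
def completedSubalgebra (G : Type u) [Group G] [TopologicalSpace G] :
    Subalgebra k ((U : OpenNormalSubgroup G) → MonoidAlgebra k (G ⧸ U.toSubgroup)) where
  carrier := {a | ∀ (U V : OpenNormalSubgroup G) (h : U ≤ V), transition k h (a U) = a V}
  mul_mem' := fun ha hb U V h => by
    simp only [Pi.mul_apply, map_mul, ha U V h, hb U V h]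
  add_mem' := fun ha hb U V h => by
    simp only [Pi.add_apply, map_add, ha U V h, hb U V h]
  algebraMap_mem' := fun r U V h => by
    simp only [Pi.algebraMap_apply, AlgHom.commutes]

/-- The completed group algebra `k[[G]] = lim k[G/U]`, over all open normal subgroups `U`. -/
abbrev CompletedGroupAlgebra (G : Type u) [Group G] [TopologicalSpace G] : Type (max u w) :=
  completedSubalgebra k G

/-- The canonical map `G → k[[G]]`. -/
def ofGroup {G : Type u} [Group G] [TopologicalSpace G] : G →* CompletedGroupAlgebra k G where
  toFun g := ⟨fun U => MonoidAlgebra.of k (G ⧸ U.toSubgroup) (QuotientGroup.mk g), fun U V h => by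
    simp only [transition, MonoidAlgebra.of_apply, MonoidAlgebra.mapDomainAlgHom_apply,
      MonoidAlgebra.mapDomain_single]
    rfl⟩
  map_one' := Subtype.ext (funext fun U => map_one (MonoidAlgebra.of k (G ⧸ U.toSubgroup)))
  map_mul' g g' := Subtype.ext (funext fun U =>
    map_mul (MonoidAlgebra.of k (G ⧸ U.toSubgroup)) (QuotientGroup.mk g) (QuotientGroup.mk g'))

/-- The open normal subgroup `G` of `G`. -/
def wholeGroup (G : Type u) [Group G] [TopologicalSpace G] : OpenNormalSubgroup G where
  toSubgroup := ⊤
  isOpen' := isOpen_univ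
  isNormal' := inferInstance

/-- The augmentation `ε : k[[G]] → k`: the sum of the coefficients of the component in `k[G/U]`,
for any `U`; here `U = G`. -/
def augmentation (G : Type u) [Group G] [TopologicalSpace G] : CompletedGroupAlgebra k G →ₐ[k] k :=
  ((MonoidAlgebra.lift k k (G ⧸ (wholeGroup G).toSubgroup) 1).comp
    (Pi.evalAlgHom k (fun U : OpenNormalSubgroup G => MonoidAlgebra k (G ⧸ U.toSubgroup))
      (wholeGroup G))).comp (completedSubalgebra k G).val

/-- The augmentation ideal `I` of `k[[G]]`. -/
abbrev augIdeal (G : Type u) [Group G] [TopologicalSpace G] : Ideal (CompletedGroupAlgebra k G) :=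
  RingHom.ker (augmentation k G)

/-- The preimage of an open normal subgroup under a continuous homomorphism. -/
def comapOpen {F : Type u} {G : Type v} [Group F] [TopologicalSpace F] [Group G]
    [TopologicalSpace G] (φ : F →ₜ* G) (U : OpenNormalSubgroup G) : OpenNormalSubgroup F where
  toSubgroup := U.toSubgroup.comap φ.toMonoidHom
  isOpen' := U.isOpen'.preimage φ.continuous_toFun
  isNormal' := inferInstance

/-- The homomorphism `k[F/φ⁻¹U] → k[G/U]` induced by `φ : F → G`. -/
def componentMap {F : Type u} {G : Type v} [Group F] [TopologicalSpace F] [Group G]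
    [TopologicalSpace G] (φ : F →ₜ* G) (U : OpenNormalSubgroup G) :
    MonoidAlgebra k (F ⧸ (comapOpen φ U).toSubgroup) →ₐ[k] MonoidAlgebra k (G ⧸ U.toSubgroup) :=
  MonoidAlgebra.mapDomainAlgHom k k
    (QuotientGroup.map (comapOpen φ U).toSubgroup U.toSubgroup φ.toMonoidHom (fun _ hx => hx))

theorem componentMap_transition {F : Type u} {G : Type v} [Group F] [TopologicalSpace F] [Group G]
    [TopologicalSpace G] (φ : F →ₜ* G) {U V : OpenNormalSubgroup G} (h : U ≤ V)
    (h' : comapOpen φ U ≤ comapOpen φ V)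
    (a : MonoidAlgebra k (F ⧸ (comapOpen φ U).toSubgroup)) :
    transition k h (componentMap k φ U a) = componentMap k φ V (transition k h' a) := by
  simp only [transition, componentMap, ← AlgHom.comp_apply, ← MonoidAlgebra.mapDomainAlgHom_comp]
  congr 2
  ext x
  rfl

/-- The homomorphism `k[[F]] → k[[G]]` induced by a continuous homomorphism `φ : F → G`. -/
def mapCompleted {F : Type u} {G : Type v} [Group F] [TopologicalSpace F] [Group G]
    [TopologicalSpace G] (φ : F →ₜ* G) :
    CompletedGroupAlgebra k F →ₐ[k] CompletedGroupAlgebra k G :=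
  AlgHom.codRestrict
    ((AlgHom.pi fun U => (componentMap k φ U).comp (Pi.evalAlgHom k
        (fun U : OpenNormalSubgroup F => MonoidAlgebra k (F ⧸ U.toSubgroup))
        (comapOpen φ U))).comp (completedSubalgebra k F).val)
    (completedSubalgebra k G)
    (fun a U V h => by
      have h' : comapOpen φ U ≤ comapOpen φ V := fun _ hx => h hx
      exact (componentMap_transition k φ h h' _).trans
        (congrArg (componentMap k φ V) (a.2 _ _ h')))

end CompletedGroupAlgebra

/-! ### The Zassenhaus filtration -/

section Zassenhaus

variable (p : ℕ)

/-- The modular dimension subgroup `G_n = {g | g - 1 ∈ I^n}`. -/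
def zassenhaus (G : Type u) [Group G] [TopologicalSpace G] (n : ℕ) : Subgroup G where
  carrier := {g | ofGroup (ZMod p) g - 1 ∈ augIdeal (ZMod p) G ^ n}
  one_mem' := by simp
  mul_mem' := fun {a b} ha hb => by
    have : ofGroup (ZMod p) (a * b) - 1 =
        ofGroup (ZMod p) a * (ofGroup (ZMod p) b - 1) + (ofGroup (ZMod p) a - 1) := by
      rw [map_mul, mul_sub, mul_one]; abel
    simp only [Set.mem_ofPred_eq, this]
    exact add_mem (Ideal.mul_mem_left _ _ hb) ha
  inv_mem' := fun {a} ha => by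
    have : ofGroup (ZMod p) a⁻¹ - 1 =
        -(ofGroup (ZMod p) a⁻¹ * (ofGroup (ZMod p) a - 1)) := by
      rw [mul_sub, ← map_mul, inv_mul_cancel, map_one, mul_one, neg_sub]
    simp only [Set.mem_ofPred_eq, this]
    exact neg_mem (Ideal.mul_mem_left _ _ ha)

/-- The level of `f`: the maximal `n` with `f ∈ I^n`. -/
def level {G : Type u} [Group G] [TopologicalSpace G] (f : CompletedGroupAlgebra (ZMod p) G) : ℕ :=
  sSup {n | f ∈ augIdeal (ZMod p) G ^ n}

/-- `c_n = dim k[[G]] / I^n`. -/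
def cInv (G : Type u) [Group G] [TopologicalSpace G] (n : ℕ) : ℕ :=
  Module.finrank (ZMod p) (CompletedGroupAlgebra (ZMod p) G ⧸ augIdeal (ZMod p) G ^ n)

end Zassenhaus

/-! ### Relations -/

/-- The finite sets of relations `ρ_{k,1}, …, ρ_{k,r k}` (for `k ≥ 1`) form a generating system of
relations for the closed normal subgroup `R` of `F` that is minimal with respect to the
Zassenhaus filtration: the `ρ_{k,i}` lie in `R ∩ F_k`, and for every `n ≥ 1` the `ρ_{k,i}` with
`k ≤ n` are a minimal system of generators for `R F_{n+1} / F_{n+1}` as a normal subgroup of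
`F / F_{n+1}`: they generate it, and no proper subsystem does. Subgroups of `F / F_{n+1}` are
written as subgroups of `F` that contain `F_{n+1}`. -/
structure IsMinimalRelationSystem (p : ℕ) {F : Type u} [Group F] [TopologicalSpace F]
    (R : Subgroup F) (r : ℕ → ℕ) (ρ : (Σ k : ℕ, Fin (r k)) → F) : Prop where
  count_zero : r 0 = 0
  mem : ∀ a, ρ a ∈ R
  mem_zassenhaus : ∀ a, ρ a ∈ zassenhaus p F a.1
  generates : ∀ n : ℕ, 1 ≤ n →
    Subgroup.normalClosure (ρ '' {a | a.1 ≤ n}) ⊔ zassenhaus p F (n + 1) =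
      R ⊔ zassenhaus p F (n + 1)
  minimal : ∀ n : ℕ, 1 ≤ n → ∀ T : Set (Σ k : ℕ, Fin (r k)), T ⊂ {a | a.1 ≤ n} →
    Subgroup.normalClosure (ρ '' T) ⊔ zassenhaus p F (n + 1) ≠ R ⊔ zassenhaus p F (n + 1)

/-- The number of relations of level `i`, with the convention that it is `1` for `i = 0`. -/
def relCount (r : ℕ → ℕ) (i : ℕ) : ℕ := if i = 0 then 1 else r i

/-! ### Fox derivatives and the Jacobian -/

section Fox

variable (p : ℕ) {F : Type u} {G : Type v} [Group F] [TopologicalSpace F] [Group G]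
  [TopologicalSpace G] {d : ℕ}

/-- The variable `x_j = σ_j - 1` in the completed group algebra. -/
def foxVar (σ : Fin d → F) (j : Fin d) : CompletedGroupAlgebra (ZMod p) F :=
  ofGroup (ZMod p) (σ j) - 1

open Classical in
/-- The Fox derivatives of `f`: the unique family `∂f/∂x_j` with `f = ∑ (∂f/∂x_j) x_j`. (If there
is no such unique family, the value is `0`; this does not happen for `f` in the augmentation ideal
when `F` is free pro-`p` with basis `σ`.) -/
def foxDeriv (σ : Fin d → F) (f : CompletedGroupAlgebra (ZMod p) F) :
    Fin d → CompletedGroupAlgebra (ZMod p) F :=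
  if h : ∃! D : Fin d → CompletedGroupAlgebra (ZMod p) F, f = ∑ j, D j * foxVar p σ j
  then h.exists.choose else 0

/-- The row `g ↦ (g φ(∂f/∂x_1), …, g φ(∂f/∂x_d))` of the Jacobian, a homomorphism of left
`k[[G]]`-modules. -/
def jacobianRow (φ : F →ₜ* G) (σ : Fin d → F) (f : CompletedGroupAlgebra (ZMod p) F) :
    CompletedGroupAlgebra (ZMod p) G →ₗ[CompletedGroupAlgebra (ZMod p) G]
      (Fin d → CompletedGroupAlgebra (ZMod p) G) :=
  LinearMap.pi fun j => LinearMap.toSpanSingleton _ _ (mapCompleted (ZMod p) φ (foxDeriv p σ f j))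

/-- The row of the Jacobian followed by reduction modulo `I^(n-1)`. -/
def jacobianRowMod (φ : F →ₜ* G) (σ : Fin d → F) (f : CompletedGroupAlgebra (ZMod p) F) (n : ℕ) :
    CompletedGroupAlgebra (ZMod p) G →ₗ[CompletedGroupAlgebra (ZMod p) G]
      (Fin d → CompletedGroupAlgebra (ZMod p) G ⧸ augIdeal (ZMod p) G ^ (n - 1)) :=
  (LinearMap.pi fun j => (Submodule.mkQ _).comp (LinearMap.proj j)).comp (jacobianRow p φ σ f)

/-- The row of the Jacobian vanishes on `I^(n - v(f))` modulo `I^(n-1)`, so that it induces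
a map on `k[[G]] / I^(n - v(f))`. -/
def RowDescends (φ : F →ₜ* G) (σ : Fin d → F) (f : CompletedGroupAlgebra (ZMod p) F) (n : ℕ) :
    Prop :=
  augIdeal (ZMod p) G ^ (n - level p f) ≤ LinearMap.ker (jacobianRowMod p φ σ f n)

open Classical in
/-- The map `k[[G]] / I^(n - v(f)) → ⨁_{j=1}^d k[[G]] / I^(n-1)` induced by the row of the
Jacobian (and `0` if the row should not induce a map). -/
def truncatedRow (φ : F →ₜ* G) (σ : Fin d → F) (f : CompletedGroupAlgebra (ZMod p) F) (n : ℕ) :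
    (CompletedGroupAlgebra (ZMod p) G ⧸ augIdeal (ZMod p) G ^ (n - level p f))
      →ₗ[CompletedGroupAlgebra (ZMod p) G]
      (Fin d → CompletedGroupAlgebra (ZMod p) G ⧸ augIdeal (ZMod p) G ^ (n - 1)) :=
  if h : RowDescends p φ σ f n then Submodule.liftQ _ (jacobianRowMod p φ σ f n) h else 0

/-- The truncated Jacobian
`J_n : ⨁_a k[[G]] / I^(n - v(f_a)) → ⨁_{j=1}^d k[[G]] / I^(n-1)` of a family `f`. Since exponents
are natural numbers, `I^(n - v(f_a)) = k[[G]]` for `n ≤ v(f_a)`. -/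
def truncatedJacobian (φ : F →ₜ* G) (σ : Fin d → F) {A : Type w} [DecidableEq A]
    (f : A → CompletedGroupAlgebra (ZMod p) F) (n : ℕ) :
    (⨁ a, CompletedGroupAlgebra (ZMod p) G ⧸ augIdeal (ZMod p) G ^ (n - level p (f a)))
      →ₗ[CompletedGroupAlgebra (ZMod p) G]
      (Fin d → CompletedGroupAlgebra (ZMod p) G ⧸ augIdeal (ZMod p) G ^ (n - 1)) :=
  DirectSum.toModule _ _ _ fun a => truncatedRow p φ σ (f a) n

/-- The kernel of the truncated Jacobian, as a vector space over `𝔽_p`. -/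
abbrev jacobianKer (φ : F →ₜ* G) (σ : Fin d → F) {A : Type w} [DecidableEq A]
    (f : A → CompletedGroupAlgebra (ZMod p) F) (n : ℕ) :
    Submodule (ZMod p)
      (⨁ a, CompletedGroupAlgebra (ZMod p) G ⧸ augIdeal (ZMod p) G ^ (n - level p (f a))) :=
  (LinearMap.ker (truncatedJacobian p φ σ f n)).restrictScalars (ZMod p)

/-- `e_n = dim ker J_n`. -/
def eInv (φ : F →ₜ* G) (σ : Fin d → F) {A : Type w} [DecidableEq A]
    (f : A → CompletedGroupAlgebra (ZMod p) F) (n : ℕ) : ℕ :=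
  Module.finrank (ZMod p) (jacobianKer p φ σ f n)

end Fox

end

end GolodShafarevich

open GolodShafarevich

/-! The theorem is a dimension count along an exact sequence of left 𝔽_p[[G]]-modules ⨁
𝔽_p[[G]]/I^(n-k) → (𝔽_p[[G]]/I^(n-1))^d → 𝔽_p[[G]]/I^n → 𝔽_p → 0, whose maps are J_n, (g_j) ↦ ∑ g_j
φ(x_j) and the augmentation. All terms are finite-dimensional, and the summands with k ≥ n vanish,
so the alternating sum of dimensions is the formula.

Fox derivatives exist and are unique because I_F is a free left module on the x_j. For a free basis
τ this comes from crossed homomorphisms into finite group algebras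
(`IsFreeProPOn.eq_zero_of_sum_mul_eq_zero`). The σ_j also generate I_F, by a Nakayama argument
modulo I_F^2 (`augIdeal_eq_span_of_isMinimalGenerating`), and d generators of a free module of rank
d are free here, because matrix rings over finite rings are Dedekind finite
(`eq_zero_of_sum_mul_eq_zero_of_span`).

The essential point is exactness in the middle (`mem_of_foxSum_eq_zero`). Lift a kernel element to b
= ∑ D_j x_j, so that φ(b) ∈ I_G^n. Then b lies in the left ideal generated by I_F^n and the g - 1
with g ∈ R (`mem_of_mapCompleted_mem_pow`). Modulo products (g - 1)i with i ∈ I_F, whose derivatives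
die in G, and modulo I_F^n, the g - 1 are generated by the ρ_{k,i} - 1 with k < n, since these
ρ_{k,i} generate RF_n/F_n (`IsMinimalRelationSystem.sub_one_mem`). By freeness the D_j then
represent an element of the image of J_n.

Minimality of the relations serves only to make the levels exact: a ρ_{k,i} in F_{k+1} would be
superfluous for n = k. -/

namespace GolodShafarevich

/-! ### Finite levels of the completed group algebra -/

section Projection

variable (k : Type w) [CommRing k] {G : Type u} [Group G] [TopologicalSpace G]

/-- The projection `k[[G]] → k[G/U]`. -/
noncomputable def proj (U : OpenNormalSubgroup G) :
    CompletedGroupAlgebra k G →ₐ[k] MonoidAlgebra k (G ⧸ U.toSubgroup) :=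
  (Pi.evalAlgHom k (fun U : OpenNormalSubgroup G => MonoidAlgebra k (G ⧸ U.toSubgroup)) U).comp
    (completedSubalgebra k G).val

theorem proj_ofGroup (U : OpenNormalSubgroup G) (g : G) :
    proj k U (ofGroup k g) = MonoidAlgebra.of k (G ⧸ U.toSubgroup) (QuotientGroup.mk g) := rfl

theorem transition_proj {U V : OpenNormalSubgroup G} (h : U ≤ V) (b : CompletedGroupAlgebra k G) :
    transition k h (proj k U b) = proj k V b := b.2 U V h

theorem eq_of_forall_proj_eq {a b : CompletedGroupAlgebra k G}
    (h : ∀ U, proj k U a = proj k U b) : a = b :=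
  Subtype.ext (funext h)

theorem proj_surjective (U : OpenNormalSubgroup G) : Function.Surjective (proj k U) := by
  intro a
  induction a using MonoidAlgebra.induction_linear with
  | zero => exact ⟨0, map_zero _⟩
  | add x y hx hy =>
    obtain ⟨x, rfl⟩ := hx
    obtain ⟨y, rfl⟩ := hy
    exact ⟨x + y, map_add _ _ _⟩
  | single q c =>
    obtain ⟨g, rfl⟩ := QuotientGroup.mk_surjective q
    refine ⟨c • ofGroup k g, ?_⟩
    rw [map_smul, proj_ofGroup, MonoidAlgebra.of_apply, MonoidAlgebra.smul_single, smul_eq_mul,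
      mul_one]

theorem transition_single {U V : OpenNormalSubgroup G} (h : U ≤ V) (g : G) (c : k) :
    transition k h (MonoidAlgebra.single (QuotientGroup.mk g) c) =
      MonoidAlgebra.single (QuotientGroup.mk g) c := by
  simp only [transition, MonoidAlgebra.mapDomainAlgHom_apply, MonoidAlgebra.mapDomain_single]
  rfl

theorem le_wholeGroup (U : OpenNormalSubgroup G) : U ≤ wholeGroup G := fun _ _ => trivial

theorem augmentation_apply (U : OpenNormalSubgroup G) (b : CompletedGroupAlgebra k G) :
    augmentation k G b = MonoidAlgebra.lift k k (G ⧸ U.toSubgroup) 1 (proj k U b) := by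
  have h1 : augmentation k G b =
      MonoidAlgebra.lift k k (G ⧸ (wholeGroup G).toSubgroup) 1 (proj k (wholeGroup G) b) := rfl
  rw [h1, ← transition_proj k (le_wholeGroup U)]
  generalize proj k U b = a
  induction a using MonoidAlgebra.induction_linear with
  | zero => simp
  | add x y hx hy => rw [map_add, map_add, map_add, hx, hy]
  | single q c =>
    obtain ⟨g, rfl⟩ := QuotientGroup.mk_surjective q
    rw [transition_single, MonoidAlgebra.lift_single, MonoidAlgebra.lift_single]
    rfl

theorem augmentation_ofGroup (g : G) : augmentation k G (ofGroup k g) = 1 := by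
  rw [augmentation_apply k (wholeGroup G), proj_ofGroup, MonoidAlgebra.lift_of]
  rfl

theorem ofGroup_sub_one_mem (g : G) : ofGroup k g - 1 ∈ augIdeal k G := by
  rw [RingHom.mem_ker, map_sub, augmentation_ofGroup, map_one, sub_self]

/-- The kernel of `k[G/U] → k[G/V]` is generated by the `v - 1` with `v ∈ V`. -/
theorem mem_of_transition_eq_zero {U V : OpenNormalSubgroup G} (h : U ≤ V)
    (N : Ideal (MonoidAlgebra k (G ⧸ U.toSubgroup)))
    (hN : ∀ g ∈ V, MonoidAlgebra.of k (G ⧸ U.toSubgroup) (QuotientGroup.mk g) - 1 ∈ N)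
    {b : MonoidAlgebra k (G ⧸ U.toSubgroup)} (hb : transition k h b = 0) : b ∈ N := by
  classical
  -- `L` lifts each coset of V to a chosen representative. An element differs from the lift of its
  -- image by an element of `N`, and the lift of `0` is `0`.
  let L : MonoidAlgebra k (G ⧸ V.toSubgroup) →+ MonoidAlgebra k (G ⧸ U.toSubgroup) :=
    { toFun := MonoidAlgebra.mapDomain fun q => QuotientGroup.mk q.out
      map_zero' := MonoidAlgebra.mapDomain_zero _
      map_add' := fun x y => MonoidAlgebra.mapDomain_add _ x y }
  suffices H : ∀ a, a - L (transition k h a) ∈ N by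
    have := H b
    rwa [hb, map_zero, sub_zero] at this
  intro a
  induction a using MonoidAlgebra.induction_linear with
  | zero => simp
  | add x y hx hy =>
    rw [map_add, map_add, add_sub_add_comm]
    exact add_mem hx hy
  | single q c =>
    obtain ⟨g, rfl⟩ := QuotientGroup.mk_surjective q
    rw [transition_single]
    set g' : G := (QuotientGroup.mk g : G ⧸ V.toSubgroup).out
    have hL : L (MonoidAlgebra.single (QuotientGroup.mk g) c) =
        MonoidAlgebra.single (QuotientGroup.mk g') c := MonoidAlgebra.mapDomain_single
    have hg : g'⁻¹ * g ∈ V :=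
      QuotientGroup.eq.1 (QuotientGroup.out_eq' (QuotientGroup.mk g : G ⧸ V.toSubgroup))
    have : MonoidAlgebra.single (QuotientGroup.mk g : G ⧸ U.toSubgroup) c -
        L (MonoidAlgebra.single (QuotientGroup.mk g) c) =
        MonoidAlgebra.single (QuotientGroup.mk g' : G ⧸ U.toSubgroup) c *
          (MonoidAlgebra.of k (G ⧸ U.toSubgroup) (QuotientGroup.mk (g'⁻¹ * g)) - 1) := by
      rw [hL, mul_sub, mul_one, MonoidAlgebra.of_apply, MonoidAlgebra.single_mul_single, mul_one,
        ← QuotientGroup.mk_mul, mul_inv_cancel_left]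
    rw [this]
    exact N.mul_mem_left _ (hN _ hg)

end Projection

/-! ### Compactness of the completed group algebra -/

section Compactness

variable {k : Type w} [CommRing k] [Finite k] {G : Type u} [Group G] [TopologicalSpace G]
  [IsTopologicalGroup G] [CompactSpace G]

instance finite_quotient (U : OpenNormalSubgroup G) : Finite (G ⧸ U.toSubgroup) :=
  Subgroup.quotient_finite_of_isOpen _ U.isOpen'

instance finite_monoidAlgebra (P : Type*) [Finite P] : Finite (MonoidAlgebra k P) :=
  Finite.of_injective (fun x : MonoidAlgebra k P => (x.coeff : P → k))
    (DFunLike.coe_injective.comp MonoidAlgebra.coeff_injective)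

open CategoryTheory in
/-- Compactness: a compatible system of conditions on finitely many elements of `k[[G]]` can be
satisfied if it can be satisfied at every finite level. -/
theorem exists_forall_proj {ι : Type v} [Finite ι]
    (C : ∀ U : OpenNormalSubgroup G, (ι → MonoidAlgebra k (G ⧸ U.toSubgroup)) → Prop)
    (hC : ∀ (U V) (h : U ≤ V) (B), C U B → C V (fun i => transition k h (B i)))
    (hne : ∀ U, ∃ B, C U B) :
    ∃ B : ι → CompletedGroupAlgebra k G, ∀ U, C U (fun i => proj k U (B i)) := by
  -- The solutions at the finite levels form a cofiltered system of finite nonempty sets, so a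
  -- compatible choice exists.
  let S : OpenNormalSubgroup G ⥤ Type (max u v w) :=
    { obj := fun U => {B : ι → MonoidAlgebra k (G ⧸ U.toSubgroup) // C U B}
      map := fun {U V} h => TypeCat.ofHom fun B =>
        ⟨fun i => transition k (leOfHom h) (B.1 i), hC U V (leOfHom h) B.1 B.2⟩
      map_id := fun U => by
        refine ConcreteCategory.hom_ext _ _ fun B => Subtype.ext (funext fun i => ?_)
        change transition k (le_refl U) (B.1 i) = B.1 i
        obtain ⟨b, hb⟩ := proj_surjective k U (B.1 i)
        rw [← hb, transition_proj]
      map_comp := fun {U V W} f g => by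
        refine ConcreteCategory.hom_ext _ _ fun B => Subtype.ext (funext fun i => ?_)
        change transition k (leOfHom (f ≫ g)) (B.1 i) =
          transition k (leOfHom g) (transition k (leOfHom f) (B.1 i))
        obtain ⟨b, hb⟩ := proj_surjective k U (B.1 i)
        rw [← hb, transition_proj, transition_proj, transition_proj] }
  have : ∀ U, Finite (S.obj U) := fun U => inferInstanceAs (Finite {B // C U B})
  have : ∀ U, Nonempty (S.obj U) := fun U => let ⟨B, hB⟩ := hne U; ⟨⟨B, hB⟩⟩
  obtain ⟨s, hs⟩ := nonempty_sections_of_finite_cofiltered_system S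
  refine ⟨fun i => ⟨fun U => (s U).1 i, fun U V h => ?_⟩, fun U => (s U).2⟩
  exact congrFun (congrArg Subtype.val (hs (homOfLE h))) i

/-- Finitely generated left ideals of `k[[G]]` are closed. -/
theorem mem_of_forall_proj {N : Ideal (CompletedGroupAlgebra k G)} (hN : N.FG)
    {b : CompletedGroupAlgebra k G} (h : ∀ U, ∃ c ∈ N, proj k U c = proj k U b) : b ∈ N := by
  obtain ⟨s, rfl⟩ := hN
  -- The unknowns are the coefficients of `b` with respect to a fixed finite generating set of the
  -- ideal.
  obtain ⟨B, hB⟩ := exists_forall_proj (k := k) (G := G) (ι := s)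
    (fun U B => proj k U b = ∑ i : s, B i * proj k U i.1)
    (fun U V h B hB => by
      simp only [← transition_proj k h, hB, map_sum, map_mul])
    (fun U => by
      obtain ⟨c, hc, hcb⟩ := h U
      obtain ⟨f, hf⟩ := (Submodule.mem_span_finset'.1 hc)
      refine ⟨fun i => proj k U (f i), ?_⟩
      simp only [← hcb, ← hf, smul_eq_mul, map_sum, map_mul])
  refine Submodule.mem_span_finset'.2 ⟨B, eq_of_forall_proj_eq k fun U => ?_⟩
  simp only [smul_eq_mul, map_sum, map_mul, hB U]

end Compactness

/-! ### Nilpotency of the augmentation ideal at finite levels -/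

section Nilpotency

variable (p : ℕ) [Fact p.Prime]

theorem smul_eq_of_fixed {P M : Type*} [Group P] [AddCommGroup M]
    [Module (MonoidAlgebra (ZMod p) P) M] {x : M}
    (hx : ∀ g, MonoidAlgebra.of (ZMod p) P g • x = x) (a : MonoidAlgebra (ZMod p) P) :
    a • x = algebraMap (ZMod p) (MonoidAlgebra (ZMod p) P)
      (MonoidAlgebra.lift (ZMod p) (ZMod p) P 1 a) • x := by
  induction a using MonoidAlgebra.induction_linear with
  | zero => simp
  | add y z hy hz => rw [add_smul, hy, hz, map_add, map_add, add_smul]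
  | single g c =>
    have : MonoidAlgebra.single g c =
        algebraMap (ZMod p) (MonoidAlgebra (ZMod p) P) c * MonoidAlgebra.of (ZMod p) P g := by
      simp [MonoidAlgebra.single_mul_single]
    rw [MonoidAlgebra.lift_single, this, mul_smul, hx]
    simp

/-- Every nonzero element of `M` has order p, so p divides the order of `M`. The number of fixed
points is then divisible by p as well, and `0` is one of them. -/
theorem exists_fixed_ne_zero {P M : Type*} [Group P] (hP : IsPGroup p P) [AddCommGroup M]
    [Module (MonoidAlgebra (ZMod p) P) M] [Finite M] [Nontrivial M] :
    ∃ x : M, x ≠ 0 ∧ ∀ g, MonoidAlgebra.of (ZMod p) P g • x = x := by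
  let _ : MulAction P M := MulAction.compHom M (MonoidAlgebra.of (ZMod p) P)
  have hcard : p ∣ Nat.card M := by
    obtain ⟨x, hx⟩ := exists_ne (0 : M)
    have : addOrderOf x = p := by
      refine addOrderOf_eq_prime ?_ hx
      have h0 : ((p : ℕ) : MonoidAlgebra (ZMod p) P) = 0 := by
        rw [← map_natCast (algebraMap (ZMod p) (MonoidAlgebra (ZMod p) P)), ZMod.natCast_self,
          map_zero]
      rw [← Nat.cast_smul_eq_nsmul (MonoidAlgebra (ZMod p) P), h0, zero_smul]
    exact this ▸ addOrderOf_dvd_natCard x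
  obtain ⟨x, hx, hne⟩ := hP.exists_fixed_point_of_prime_dvd_card_of_fixed_point M hcard
    (a := 0) (fun g => smul_zero (MonoidAlgebra.of (ZMod p) P g))
  exact ⟨x, hne.symm, fun g => hx g⟩

variable {G : Type u} [Group G] [TopologicalSpace G]

/-- Induction on the order of `M`: the ideal I kills the span of a nonzero fixed vector, and the
quotient by that span is smaller. -/
theorem exists_pow_smul_eq_zero (U : OpenNormalSubgroup G) (hU : IsPGroup p (G ⧸ U.toSubgroup))
    (n : ℕ) : ∀ (M : Type u) [AddCommGroup M]
    [Module (MonoidAlgebra (ZMod p) (G ⧸ U.toSubgroup)) M] [Finite M], Nat.card M ≤ n →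
    ∃ m : ℕ, ∀ b ∈ augIdeal (ZMod p) G ^ m, ∀ x : M, proj (ZMod p) U b • x = 0 := by
  induction n with
  | zero =>
    intro M _ _ _ h
    exact absurd h (by have := Nat.card_pos (α := M); omega)
  | succ n ih =>
    intro M _ _ _ h
    cases subsingleton_or_nontrivial M
    · exact ⟨0, fun b _ x => Subsingleton.elim _ _⟩
    obtain ⟨x, hx0, hx⟩ := exists_fixed_ne_zero p hU (M := M)
    let X := Submodule.span (MonoidAlgebra (ZMod p) (G ⧸ U.toSubgroup)) {x}
    have hfix : ∀ i ∈ augIdeal (ZMod p) G, ∀ y ∈ X, proj (ZMod p) U i • y = 0 := by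
      intro i hi y hy
      obtain ⟨a, rfl⟩ := Submodule.mem_span_singleton.1 hy
      rw [smul_smul, smul_eq_of_fixed p hx, map_mul, ← augmentation_apply, RingHom.mem_ker.1 hi,
        zero_mul, map_zero, zero_smul]
    have : Finite (M ⧸ X) := Finite.of_surjective _ X.mkQ_surjective
    have hlt : Nat.card (M ⧸ X) < Nat.card M := by
      have h1 := X.card_eq_card_quotient_mul_card
      have h2 : 1 < Nat.card X := by
        rw [Finite.one_lt_card_iff_nontrivial]
        exact ⟨⟨x, Submodule.mem_span_singleton_self x⟩, 0, fun h => hx0 (congrArg Subtype.val h)⟩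
      have h3 := Nat.card_pos (α := M ⧸ X)
      rw [h1]
      nlinarith
    obtain ⟨m, hm⟩ := ih (M ⧸ X) (by omega)
    refine ⟨m + 1, fun b hb y => ?_⟩
    -- Split as I · I^m: the right factor acts first and moves `y` into `X`, which the left factor
    -- kills.
    rw [Ideal.IsTwoSided.pow_succ] at hb
    refine Submodule.mul_induction_on hb (fun i hi c hc => ?_) (fun a b ha hb => ?_)
    · rw [map_mul, mul_smul]
      refine hfix i hi _ ?_
      have := hm c hc (Submodule.Quotient.mk y)
      rwa [← Submodule.Quotient.mk_smul, Submodule.Quotient.mk_eq_zero] at this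
    · rw [map_add, add_smul, ha, hb, add_zero]

theorem exists_pow_le_ker_proj [IsProP p G] (U : OpenNormalSubgroup G) :
    ∃ m : ℕ, ∀ b ∈ augIdeal (ZMod p) G ^ m, proj (ZMod p) U b = 0 := by
  obtain ⟨m, hm⟩ := exists_pow_smul_eq_zero p U (IsProP.isPGroup_quotient U) _
    (MonoidAlgebra (ZMod p) (G ⧸ U.toSubgroup)) le_rfl
  exact ⟨m, fun b hb => by simpa using hm b hb 1⟩

end Nilpotency

/-! ### Powers of a finitely generated two-sided ideal -/

section LeftIdeals

variable {R : Type*} [Ring R] {ι : Type*} [Fintype ι] {I : Ideal R} {x : ι → R}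

theorem mem_span_range_iff {b : R} :
    b ∈ Ideal.span (Set.range x) ↔ ∃ B : ι → R, ∑ j, B j * x j = b :=
  Submodule.mem_span_range_iff_exists_fun R

variable [I.IsTwoSided]

theorem pow_le_pow {m n : ℕ} (h : m ≤ n) : I ^ n ≤ I ^ m := by
  obtain ⟨l, rfl⟩ := Nat.exists_eq_add_of_le h
  rw [Ideal.IsTwoSided.pow_add]
  exact Ideal.mul_le_left

/-- Right multiplication by `y ∈ I` as a map `R / I^m → R / I^n` for `n ≤ m + 1`. -/
def mulRightMod {m n : ℕ} (hmn : n ≤ m + 1) (y : R) (hy : y ∈ I) :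
    (R ⧸ I ^ m) →ₗ[R] (R ⧸ I ^ n) :=
  Submodule.mapQ _ _ (LinearMap.toSpanSingleton R R y) fun b hb => by
    refine pow_le_pow hmn ?_
    change b • y ∈ I ^ (m + 1)
    rw [Submodule.pow_succ]
    exact Submodule.mul_mem_mul hb hy

/-- Since I^n is two-sided, multiplying the coefficients of an element of I by I^n keeps them in
I^n. This is the degree shift by one behind the Fox derivatives. -/
theorem mem_pow_succ_iff (hI : I = Ideal.span (Set.range x)) (n : ℕ) {b : R} :
    b ∈ I ^ (n + 1) ↔ ∃ B : ι → R, (∀ j, B j ∈ I ^ n) ∧ ∑ j, B j * x j = b := by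
  constructor
  · intro hb
    rw [Submodule.pow_succ] at hb
    refine Submodule.mul_induction_on hb (fun a ha i hi => ?_) ?_
    · rw [hI] at hi
      obtain ⟨C, rfl⟩ := mem_span_range_iff.1 hi
      exact ⟨fun j => a * C j, fun j => Ideal.mul_mem_right _ _ ha, by
        simp only [Finset.mul_sum, mul_assoc]⟩
    · rintro a b ⟨A, hA, rfl⟩ ⟨B, hB, rfl⟩
      exact ⟨A + B, fun j => add_mem (hA j) (hB j), by
        simp only [Pi.add_apply, add_mul, Finset.sum_add_distrib]⟩
  · rintro ⟨B, hB, rfl⟩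
    rw [Submodule.pow_succ]
    refine sum_mem fun j _ => Submodule.mul_mem_mul (hB j) ?_
    rw [hI]
    exact Ideal.subset_span ⟨j, rfl⟩

theorem fg_pow (hI : I = Ideal.span (Set.range x)) (n : ℕ) : (I ^ n).FG := by
  induction n with
  | zero =>
    rw [Submodule.pow_zero, Ideal.one_eq_top]
    exact Module.Finite.fg_top
  | succ n ih =>
    obtain ⟨s, hs⟩ := ih
    have hs' : Ideal.span (s : Set R) = I ^ n := hs
    -- A product of spans of left ideals is spanned by the products of generators only if the left
    -- factor is two-sided.
    have : (Ideal.span (s : Set R)).IsTwoSided := by rw [hs']; infer_instance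
    rw [Submodule.pow_succ, ← hs']
    conv => enter [1, 2]; rw [hI]
    rw [Ideal.span_mul_span']
    exact Submodule.fg_span (s.finite_toSet.mul (Set.finite_range x))

theorem finite_quotient_pow {k : Type*} [Field k] [Algebra k R]
    (hI : I = Ideal.span (Set.range x)) (hk : ∀ b : R, ∃ c : k, b - algebraMap k R c ∈ I) (n : ℕ) :
    Module.Finite k (R ⧸ I ^ n) := by
  have hx : ∀ j, x j ∈ I := fun j => by rw [hI]; exact Ideal.subset_span ⟨j, rfl⟩
  induction n with
  | zero =>
    have : Subsingleton (R ⧸ I ^ 0) := by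
      rw [Submodule.pow_zero, Ideal.one_eq_top]
      exact Submodule.Quotient.subsingleton_iff.2 rfl
    infer_instance
  | succ n ih =>
    -- R = k + ∑ R x_j, and right multiplication by x_j factors through R/I^n into R/I^(n+1).
    let T : (k × (ι → R ⧸ I ^ n)) →ₗ[k] (R ⧸ I ^ (n + 1)) :=
      LinearMap.coprod (((I ^ (n + 1)).mkQ.restrictScalars k).comp (Algebra.linearMap k R))
        (∑ j, ((mulRightMod le_rfl (x j) (hx j)).restrictScalars k).comp (LinearMap.proj j))
    refine Module.Finite.of_surjective T fun q => ?_
    obtain ⟨b, rfl⟩ := Submodule.Quotient.mk_surjective _ q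
    obtain ⟨c, hc⟩ := hk b
    rw [hI] at hc
    obtain ⟨B, hB⟩ := mem_span_range_iff.1 hc
    refine ⟨(c, fun j => Submodule.Quotient.mk (B j)), ?_⟩
    have h1 : T (c, fun j => Submodule.Quotient.mk (B j)) =
        Submodule.Quotient.mk (algebraMap k R c) +
          ∑ j, Submodule.Quotient.mk (p := I ^ (n + 1)) (B j * x j) := by
      simp only [T, LinearMap.coprod_apply, LinearMap.sum_apply, LinearMap.comp_apply]
      rfl
    have h2 : ∑ j, Submodule.Quotient.mk (p := I ^ (n + 1)) (B j * x j) =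
        Submodule.Quotient.mk (∑ j, B j * x j) := (map_sum (I ^ (n + 1)).mkQ _ _).symm
    rw [h1, h2, hB, ← Submodule.Quotient.mk_add, add_sub_cancel]

/-- Nakayama by iteration: I² ≤ I(N + I^(m+1)) ≤ N + I^(m+2), as N is a left ideal. -/
theorem le_sup_pow {N : Ideal R} (h : I ≤ N ⊔ I ^ 2) (m : ℕ) : I ≤ N ⊔ I ^ (m + 1) := by
  induction m with
  | zero => rw [zero_add, Submodule.pow_one]; exact le_sup_right
  | succ m ih =>
    have h2 : I ^ 2 ≤ N ⊔ I ^ (m + 1 + 1) := by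
      rw [Submodule.pow_succ, Submodule.pow_one, Ideal.IsTwoSided.pow_succ (n := m + 1)]
      exact (Ideal.mul_mono_right ih).trans
        ((Ideal.mul_sup _ _ _).le.trans (sup_le_sup_right Ideal.mul_le_right _))
    exact h.trans (sup_le le_sup_left h2)

/-- The elements `g` of a group with `f g - 1` in a given left ideal. -/
def subOneSubgroup {G : Type*} [Group G] (f : G →* R) (N : Ideal R) : Subgroup G where
  carrier := {g | f g - 1 ∈ N}
  one_mem' := by simp
  mul_mem' := fun {a b} ha hb => by
    have : f (a * b) - 1 = f a * (f b - 1) + (f a - 1) := by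
      rw [map_mul, mul_sub, mul_one]; abel
    simp only [Set.mem_ofPred_eq, this]
    exact add_mem (Ideal.mul_mem_left _ _ hb) ha
  inv_mem' := fun {a} ha => by
    have : f a⁻¹ - 1 = -(f a⁻¹ * (f a - 1)) := by
      rw [mul_sub, ← map_mul, inv_mul_cancel, map_one, mul_one, neg_sub]
    simp only [Set.mem_ofPred_eq, this]
    exact neg_mem (Ideal.mul_mem_left _ _ ha)

theorem mem_subOneSubgroup {G : Type*} [Group G] {f : G →* R} {N : Ideal R} {g : G} :
    g ∈ subOneSubgroup f N ↔ f g - 1 ∈ N := Iff.rfl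

end LeftIdeals

/-! ### Generators of the group and of its augmentation ideal -/

section Generation

theorem mem_quotient_closure_of_topGenerates (p : ℕ) {G : Type u} [Group G]
    [TopologicalSpace G] [IsProP p G] {X : Type*} {s : X → G} (hs : TopGenerates s)
    (U : OpenNormalSubgroup G) (g : G) :
    ∃ h ∈ Subgroup.closure (Set.range s),
      (QuotientGroup.mk h : G ⧸ U.toSubgroup) = QuotientGroup.mk g := by
  have : IsTopologicalGroup G := IsProP.toIsTopologicalGroup p
  have ho : IsOpen ((fun x => g⁻¹ * x) ⁻¹' (U : Set G)) :=
    U.isOpen'.preimage (continuous_const_mul g⁻¹)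
  obtain ⟨h, hh, hc⟩ := hs.exists_mem_open ho ⟨g, by simp [one_mem]⟩
  exact ⟨h, hh, (QuotientGroup.eq.2 hc).symm⟩

theorem exists_sub_algebraMap_mem {p : ℕ} {G : Type u} [Group G] [TopologicalSpace G]
    (b : CompletedGroupAlgebra (ZMod p) G) :
    ∃ c : ZMod p, b - algebraMap (ZMod p) _ c ∈ augIdeal (ZMod p) G :=
  ⟨augmentation (ZMod p) G b, by
    rw [RingHom.mem_ker, map_sub, AlgHom.commutes, Algebra.algebraMap_self_apply, sub_self]⟩

theorem finite_quotient_augIdeal_pow {p : ℕ} [Fact p.Prime] {G : Type u} [Group G]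
    [TopologicalSpace G] {ι : Type*} [Fintype ι] {x : ι → CompletedGroupAlgebra (ZMod p) G}
    (hI : augIdeal (ZMod p) G = Ideal.span (Set.range x)) (n : ℕ) :
    Module.Finite (ZMod p) (CompletedGroupAlgebra (ZMod p) G ⧸ augIdeal (ZMod p) G ^ n) :=
  finite_quotient_pow hI exists_sub_algebraMap_mem n

variable {p : ℕ} [Fact p.Prime] {G : Type u} [Group G] [TopologicalSpace G] [IsProP p G]

variable (p) in
/-- A topological generating family generates the augmentation ideal as a left ideal. -/
theorem augIdeal_eq_span {X : Type*} [Finite X] {s : X → G}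
    (hs : ∀ (U : OpenNormalSubgroup G) (g : G), ∃ h ∈ Subgroup.closure (Set.range s),
      (QuotientGroup.mk h : G ⧸ U.toSubgroup) = QuotientGroup.mk g) :
    augIdeal (ZMod p) G = Ideal.span (Set.range fun j => ofGroup (ZMod p) (s j) - 1) := by
  have : IsTopologicalGroup G := IsProP.toIsTopologicalGroup p
  have : CompactSpace G := IsProP.toCompactSpace p
  apply le_antisymm
  · intro b hb
    set N := Ideal.span (Set.range fun j => ofGroup (ZMod p) (s j) - 1)
    refine mem_of_forall_proj (Submodule.fg_span (Set.finite_range _)) fun U => ?_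
    have hsurj := proj_surjective (ZMod p) U
    refine (Ideal.mem_map_iff_of_surjective (proj (ZMod p) U) hsurj).1 ?_
    -- With V = G this says that the augmentation ideal at level U is generated by the g - 1; modulo
    -- U, every g is a word in the family.
    refine mem_of_transition_eq_zero (ZMod p) (le_wholeGroup U) _ (fun g _ => ?_) ?_
    · obtain ⟨h, hh, hg⟩ := hs U g
      have : Subgroup.closure (Set.range s) ≤ subOneSubgroup (ofGroup (ZMod p)) N := by
        rw [Subgroup.closure_le]
        rintro _ ⟨j, rfl⟩
        exact Ideal.subset_span ⟨j, rfl⟩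
      have := Ideal.mem_map_of_mem (proj (ZMod p) U) (mem_subOneSubgroup.1 (this hh))
      rwa [map_sub, map_one, proj_ofGroup, hg] at this
    · rw [transition_proj]
      have hb' := RingHom.mem_ker.1 hb
      rw [augmentation_apply _ (wholeGroup G)] at hb'
      have hsub : Subsingleton (G ⧸ (wholeGroup G).toSubgroup) :=
        QuotientGroup.subsingleton_quotient_top
      generalize proj (ZMod p) (wholeGroup G) b = a at hb'
      have ha : ∀ a : MonoidAlgebra (ZMod p) (G ⧸ (wholeGroup G).toSubgroup),
          a = algebraMap (ZMod p) _ (MonoidAlgebra.lift (ZMod p) (ZMod p) _ 1 a) := by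
        intro a
        induction a using MonoidAlgebra.induction_linear with
        | zero => simp
        | add x y hx hy => rw [map_add, map_add, ← hx, ← hy]
        | single q c => simp [Subsingleton.elim q 1]
      rw [ha a, hb', map_zero]
  · rw [Ideal.span_le]
    rintro _ ⟨j, rfl⟩
    exact ofGroup_sub_one_mem (ZMod p) (s j)

/-- A family that generates the augmentation ideal as a left ideal generates the group. -/
theorem topGenerates_of_augIdeal_le {X : Type*} [Finite X] {s : X → G}
    (hs : augIdeal (ZMod p) G ≤ Ideal.span (Set.range fun j => ofGroup (ZMod p) (s j) - 1)) :
    TopGenerates s := by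
  have : IsTopologicalGroup G := IsProP.toIsTopologicalGroup p
  have : CompactSpace G := IsProP.toCompactSpace p
  have : TotallyDisconnectedSpace G := IsProP.toTotallyDisconnectedSpace p
  have := Fintype.ofFinite X
  have key : ∀ (U : OpenNormalSubgroup G) (g : G), ∃ h ∈ Subgroup.closure (Set.range s),
      (QuotientGroup.mk h : G ⧸ U.toSubgroup) = QuotientGroup.mk g := by
    intro U g
    -- Passing to left cosets of `Q` kills all left multiples of the s_j - 1. Hence it kills g - 1,
    -- so g and 1 lie in the same coset.
    let Q : Subgroup (G ⧸ U.toSubgroup) :=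
      (Subgroup.closure (Set.range s)).map (QuotientGroup.mk' U.toSubgroup)
    let L : MonoidAlgebra (ZMod p) (G ⧸ U.toSubgroup) →+
        MonoidAlgebra (ZMod p) ((G ⧸ U.toSubgroup) ⧸ Q) :=
      { toFun := MonoidAlgebra.mapDomain (QuotientGroup.mk (s := Q))
        map_zero' := MonoidAlgebra.mapDomain_zero _
        map_add' := fun x y => MonoidAlgebra.mapDomain_add _ x y }
    have hL : ∀ q c, L (MonoidAlgebra.single q c) = MonoidAlgebra.single (QuotientGroup.mk q) c :=
      fun q c => MonoidAlgebra.mapDomain_single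
    have h0 : ∀ (j : X) (a : MonoidAlgebra (ZMod p) (G ⧸ U.toSubgroup)),
        L (a * (MonoidAlgebra.of (ZMod p) _ (QuotientGroup.mk (s j)) - 1)) = 0 := by
      intro j a
      induction a using MonoidAlgebra.induction_linear with
      | zero => simp
      | add x y hx hy => rw [add_mul, map_add, hx, hy, add_zero]
      | single q c =>
        rw [mul_sub, mul_one, MonoidAlgebra.of_apply, MonoidAlgebra.single_mul_single, mul_one,
          map_sub, hL, hL, sub_eq_zero]
        congr 1
        refine (QuotientGroup.eq.2 ?_).symm
        rw [inv_mul_cancel_left]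
        exact ⟨s j, Subgroup.subset_closure ⟨j, rfl⟩, rfl⟩
    obtain ⟨B, hB⟩ := mem_span_range_iff.1 (hs (ofGroup_sub_one_mem (ZMod p) g))
    have h1 : L (proj (ZMod p) U (ofGroup (ZMod p) g - 1)) = 0 := by
      rw [← hB, map_sum, map_sum]
      refine Finset.sum_eq_zero fun j _ => ?_
      rw [map_mul, map_sub, map_one, proj_ofGroup, h0]
    rw [map_sub, map_one, proj_ofGroup, map_sub, MonoidAlgebra.of_apply, MonoidAlgebra.one_def, hL,
      hL, sub_eq_zero, MonoidAlgebra.single_left_inj one_ne_zero, eq_comm, QuotientGroup.eq,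
      inv_one, one_mul] at h1
    exact h1
  rw [TopGenerates, dense_iff_inter_open]
  rintro O hO ⟨g, hg⟩
  obtain ⟨U, hU⟩ := ProfiniteGrp.exist_openNormalSubgroup_sub_open_nhds_of_one
    (hO.preimage (continuous_const_mul g)) (by simpa using hg)
  obtain ⟨h, hh, hc⟩ := key U g
  have := hU (QuotientGroup.eq.1 hc.symm)
  rw [Set.mem_preimage, mul_inv_cancel_left] at this
  exact ⟨h, this, hh⟩

variable {ι : Type*} [Fintype ι] {x : ι → CompletedGroupAlgebra (ZMod p) G}

/-- The powers of a finitely generated augmentation ideal are open. -/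
theorem exists_ker_proj_le (hI : augIdeal (ZMod p) G = Ideal.span (Set.range x)) (n : ℕ) :
    ∃ U : OpenNormalSubgroup G, ∀ b, proj (ZMod p) U b = 0 → b ∈ augIdeal (ZMod p) G ^ n := by
  have : IsTopologicalGroup G := IsProP.toIsTopologicalGroup p
  have : CompactSpace G := IsProP.toCompactSpace p
  have := finite_quotient_augIdeal_pow hI n
  have : Finite (CompletedGroupAlgebra (ZMod p) G ⧸ augIdeal (ZMod p) G ^ n) :=
    Module.finite_of_finite (ZMod p)
  -- I^n is closed, so each nonzero class modulo I^n is disjoint from the kernel of some projection.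
  -- There are finitely many classes, so one U serves for all.
  have key : ∀ q : CompletedGroupAlgebra (ZMod p) G ⧸ augIdeal (ZMod p) G ^ n,
      ∃ U : OpenNormalSubgroup G, ∀ b, Submodule.Quotient.mk b = q → proj (ZMod p) U b = 0 →
        q = 0 := by
    intro q
    obtain ⟨a, rfl⟩ := Submodule.Quotient.mk_surjective _ q
    by_cases ha : a ∈ augIdeal (ZMod p) G ^ n
    · exact ⟨wholeGroup G, fun b _ _ => (Submodule.Quotient.mk_eq_zero _).2 ha⟩
    · have := mt (mem_of_forall_proj (fg_pow hI n)) ha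
      push Not at this
      obtain ⟨U, hU⟩ := this
      refine ⟨U, fun b hb hb0 => absurd ?_ (hU (a - b) ?_)⟩
      · rw [map_sub, hb0, sub_zero]
      · exact (Submodule.Quotient.eq _).1 hb.symm
  choose U hU using key
  have : Nonempty (OpenNormalSubgroup G) := ⟨wholeGroup G⟩
  obtain ⟨V, hV⟩ := Finite.exists_ge U
  refine ⟨V, fun b hb => (Submodule.Quotient.mk_eq_zero _).1 (hU _ b rfl ?_)⟩
  rw [← transition_proj _ (hV _), hb, map_zero]

/-- Nakayama in the topological form: the error term in I^(m+1) vanishes at any given finite level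
for large m, and finitely generated left ideals are closed. -/
theorem augIdeal_le_of_le_sup_sq {N : Ideal (CompletedGroupAlgebra (ZMod p) G)} (hN : N.FG)
    (h : augIdeal (ZMod p) G ≤ N ⊔ augIdeal (ZMod p) G ^ 2) : augIdeal (ZMod p) G ≤ N := by
  have : IsTopologicalGroup G := IsProP.toIsTopologicalGroup p
  have : CompactSpace G := IsProP.toCompactSpace p
  intro b hb
  refine mem_of_forall_proj hN fun U => ?_
  obtain ⟨m, hm⟩ := exists_pow_le_ker_proj p U
  obtain ⟨c, hc, e, he, hce⟩ := Submodule.mem_sup.1 (le_sup_pow h m hb)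
  refine ⟨c, hc, ?_⟩
  rw [← hce, map_add, hm e (pow_le_pow m.le_succ he), add_zero]

variable (p) in
/-- A minimal generating system is linearly independent modulo `I^2`. -/
theorem linearIndependent_of_isMinimalGenerating {d : ℕ} {s : Fin d → G}
    (hs : IsMinimalGenerating s) (c : Fin d → ZMod p)
    (hc : ∑ j, c j • (ofGroup (ZMod p) (s j) - 1) ∈ augIdeal (ZMod p) G ^ 2) : c = 0 := by
  by_contra hne
  obtain ⟨j₀, hj₀⟩ := Function.ne_iff.1 hne
  rw [Pi.zero_apply] at hj₀
  obtain _ | d := d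
  · exact j₀.elim0
  -- A relation with nonzero coefficient at `j₀` makes s_{j₀} - 1 redundant modulo I², so the family
  -- without s_{j₀} still generates, against minimality.
  let t : Fin d → G := fun i => s (j₀.succAbove i)
  suffices ht : TopGenerates t by
    have := hs.2 d t ht
    omega
  refine topGenerates_of_augIdeal_le (p := p) (augIdeal_le_of_le_sup_sq
    (Submodule.fg_span (Set.finite_range _)) ?_)
  set N := Ideal.span (Set.range fun j => ofGroup (ZMod p) (t j) - 1)
  have hN : ∀ i, ofGroup (ZMod p) (s (j₀.succAbove i)) - 1 ∈ N := fun i =>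
    Ideal.subset_span ⟨i, rfl⟩
  conv_lhs => rw [augIdeal_eq_span p (mem_quotient_closure_of_topGenerates p hs.1)]
  rw [Ideal.span_le]
  rintro _ ⟨j, rfl⟩
  obtain rfl | ⟨i, rfl⟩ := j₀.eq_self_or_eq_succAbove j
  · rw [Fin.sum_univ_succAbove _ j] at hc
    have h1 : ofGroup (ZMod p) (s j) - 1 =
        (c j)⁻¹ • ((c j • (ofGroup (ZMod p) (s j) - 1) +
          ∑ i, c (j.succAbove i) • (ofGroup (ZMod p) (s (j.succAbove i)) - 1)) -
          ∑ i, c (j.succAbove i) • (ofGroup (ZMod p) (s (j.succAbove i)) - 1)) := by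
      rw [add_sub_cancel_right, inv_smul_smul₀ hj₀]
    simp only [SetLike.mem_coe]
    rw [h1]
    refine Submodule.smul_of_tower_mem _ _ (sub_mem (Ideal.mem_sup_right hc)
      (Ideal.mem_sup_left (sum_mem fun i _ => Submodule.smul_of_tower_mem _ _ (hN i))))
  · exact Ideal.mem_sup_left (hN i)

end Generation

theorem isProP_of_finite {p : ℕ} {H : Type u} [Group H] [TopologicalSpace H] [DiscreteTopology H]
    [Finite H] (h : IsPGroup p H) : IsProP p H where
  continuous_mul := continuous_of_discreteTopology
  continuous_inv := continuous_of_discreteTopology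
  isPGroup_quotient U := h.to_quotient U.toSubgroup

/-! ### Crossed homomorphisms as homomorphisms into a semidirect product -/

section AffineGroup

/-- The semidirect product of the additive group of `k[P]` and `P`. -/
@[ext]
structure AffineGroup (k : Type*) [CommRing k] (P : Type*) [Group P] where
  /-- the translation part -/
  vec : MonoidAlgebra k P
  /-- the linear part -/
  lin : P

variable {k : Type*} [CommRing k] {P : Type*} [Group P]

namespace AffineGroup

noncomputable instance : Mul (AffineGroup k P) :=
  ⟨fun a b => ⟨a.vec + MonoidAlgebra.of k P a.lin * b.vec, a.lin * b.lin⟩⟩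

noncomputable instance : One (AffineGroup k P) := ⟨⟨0, 1⟩⟩

noncomputable instance : Inv (AffineGroup k P) :=
  ⟨fun a => ⟨-(MonoidAlgebra.of k P a.lin⁻¹ * a.vec), a.lin⁻¹⟩⟩

theorem mul_vec (a b : AffineGroup k P) :
    (a * b).vec = a.vec + MonoidAlgebra.of k P a.lin * b.vec := rfl

theorem mul_lin (a b : AffineGroup k P) : (a * b).lin = a.lin * b.lin := rfl

theorem one_vec : (1 : AffineGroup k P).vec = 0 := rfl

theorem one_lin : (1 : AffineGroup k P).lin = 1 := rfl

theorem inv_vec (a : AffineGroup k P) :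
    a⁻¹.vec = -(MonoidAlgebra.of k P a.lin⁻¹ * a.vec) := rfl

theorem inv_lin (a : AffineGroup k P) : a⁻¹.lin = a.lin⁻¹ := rfl

noncomputable instance : Group (AffineGroup k P) :=
  Group.ofLeftAxioms
    (fun a b c => AffineGroup.ext
      (by simp only [mul_vec, mul_lin, map_mul, mul_add, mul_assoc, add_assoc])
      (mul_assoc _ _ _))
    (fun a => AffineGroup.ext
      (by rw [mul_vec, one_vec, one_lin, map_one, one_mul, zero_add]) (one_mul _))
    (fun a => AffineGroup.ext
      (by rw [mul_vec, inv_vec, inv_lin, one_vec, neg_add_cancel]) (inv_mul_cancel _))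

/-- The linear part as a homomorphism. -/
def linHom : AffineGroup k P →* P where
  toFun := lin
  map_one' := rfl
  map_mul' _ _ := rfl

/-- The affine group as a set of pairs. -/
def equivProd : AffineGroup k P ≃ MonoidAlgebra k P × P where
  toFun a := (a.vec, a.lin)
  invFun a := ⟨a.1, a.2⟩

instance [Finite k] [Finite P] : Finite (AffineGroup k P) :=
  Finite.of_equiv _ equivProd.symm

theorem isPGroup {p : ℕ} [Fact p.Prime] [Finite P] (hP : IsPGroup p P) :
    IsPGroup p (AffineGroup (ZMod p) P) := by
  obtain ⟨n, hn⟩ := IsPGroup.iff_card.1 hP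
  refine IsPGroup.of_card
    (n := Module.finrank (ZMod p) (MonoidAlgebra (ZMod p) P) + n) ?_
  rw [Nat.card_congr equivProd, Nat.card_prod, Module.natCard_eq_pow_finrank (K := ZMod p),
    Nat.card_zmod, hn, pow_add]

end AffineGroup

end AffineGroup

/-! ### Freeness of the augmentation ideal of a free pro-p group -/

section Free

variable {p : ℕ} {F : Type u} [Group F] [TopologicalSpace F] [IsProP p F]

/-- The projection to a finite quotient as a continuous homomorphism. -/
def mkContinuous {F : Type u} [Group F] [TopologicalSpace F] (U : OpenNormalSubgroup F) :
    F →ₜ* F ⧸ U.toSubgroup where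
  toMonoidHom := QuotientGroup.mk' U.toSubgroup
  continuous_toFun := QuotientGroup.continuous_mk

/-- Freeness gives a map into the finite subgroup `Q` generated by the images of the basis. By
uniqueness it agrees with the projection, whose image therefore lies in `Q`. -/
theorem IsFreeProPOn.mem_quotient_closure {X : Type v} [Finite X] {τ : X → F}
    (hτ : IsFreeProPOn p τ) (U : OpenNormalSubgroup F) (g : F) :
    ∃ h ∈ Subgroup.closure (Set.range τ),
      (QuotientGroup.mk h : F ⧸ U.toSubgroup) = QuotientGroup.mk g := by
  have : IsTopologicalGroup F := IsProP.toIsTopologicalGroup p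
  have : CompactSpace F := IsProP.toCompactSpace p
  have : DiscreteTopology (F ⧸ U.toSubgroup) := QuotientGroup.discreteTopology U.isOpen'
  have hP : IsPGroup p (F ⧸ U.toSubgroup) := IsProP.isPGroup_quotient U
  have : IsProP p (F ⧸ U.toSubgroup) := isProP_of_finite hP
  let Q : Subgroup (F ⧸ U.toSubgroup) :=
    (Subgroup.closure (Set.range τ)).map (QuotientGroup.mk' U.toSubgroup)
  have : IsProP p Q := isProP_of_finite (hP.to_subgroup Q)
  obtain ⟨θ, hθ, -⟩ := hτ Q fun x =>
    ⟨QuotientGroup.mk (τ x), τ x, Subgroup.subset_closure ⟨x, rfl⟩, rfl⟩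
  let ι : Q →ₜ* F ⧸ U.toSubgroup :=
    { toMonoidHom := Q.subtype, continuous_toFun := continuous_of_discreteTopology }
  have h := (hτ (F ⧸ U.toSubgroup) fun x => QuotientGroup.mk (τ x)).unique
    (y₁ := ι.comp θ) (y₂ := mkContinuous U)
    (fun x => congrArg Subtype.val (hθ x)) (fun x => rfl)
  have hg : ((θ g : Q) : F ⧸ U.toSubgroup) = QuotientGroup.mk g := DFunLike.congr_fun h g
  obtain ⟨h, hh, hq⟩ := (θ g).2
  exact ⟨h, hh, hq.trans hg⟩

variable [Fact p.Prime]

theorem augIdeal_eq_span_of_isFreeProPOn {X : Type v} [Finite X] {τ : X → F}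
    (hτ : IsFreeProPOn p τ) : augIdeal (ZMod p) F =
      Ideal.span (Set.range fun j => ofGroup (ZMod p) (τ j) - 1) :=
  augIdeal_eq_span p hτ.mem_quotient_closure

/-- The crossed homomorphism `F → 𝔽_p[F/U]` that is `1` on `τ j` and `0` on the other
basis elements, as a homomorphism to the affine group. -/
theorem IsFreeProPOn.exists_affine {X : Type v} [Finite X] [DecidableEq X] {τ : X → F}
    (hτ : IsFreeProPOn p τ) (U : OpenNormalSubgroup F) (j : X) :
    ∃ θ : F →* AffineGroup (ZMod p) (F ⧸ U.toSubgroup), IsOpen (θ.ker : Set F) ∧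
      (∀ g, (θ g).lin = QuotientGroup.mk g) ∧ ∀ i, (θ (τ i)).vec = if i = j then 1 else 0 := by
  have : IsTopologicalGroup F := IsProP.toIsTopologicalGroup p
  have : CompactSpace F := IsProP.toCompactSpace p
  have : DiscreteTopology (F ⧸ U.toSubgroup) := QuotientGroup.discreteTopology U.isOpen'
  have hP : IsPGroup p (F ⧸ U.toSubgroup) := IsProP.isPGroup_quotient U
  have : IsProP p (F ⧸ U.toSubgroup) := isProP_of_finite hP
  let _ : TopologicalSpace (AffineGroup (ZMod p) (F ⧸ U.toSubgroup)) := ⊥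
  have : DiscreteTopology (AffineGroup (ZMod p) (F ⧸ U.toSubgroup)) := ⟨rfl⟩
  have : IsProP p (AffineGroup (ZMod p) (F ⧸ U.toSubgroup)) :=
    isProP_of_finite (AffineGroup.isPGroup hP)
  obtain ⟨θ, hθ, -⟩ := hτ (AffineGroup (ZMod p) (F ⧸ U.toSubgroup)) fun i =>
    ⟨if i = j then 1 else 0, QuotientGroup.mk (τ i)⟩
  let l : AffineGroup (ZMod p) (F ⧸ U.toSubgroup) →ₜ* F ⧸ U.toSubgroup :=
    { toMonoidHom := AffineGroup.linHom, continuous_toFun := continuous_of_discreteTopology }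
  have h := (hτ (F ⧸ U.toSubgroup) fun x => QuotientGroup.mk (τ x)).unique
    (y₁ := l.comp θ) (y₂ := mkContinuous U)
    (fun x => congrArg AffineGroup.lin (hθ x)) (fun x => rfl)
  refine ⟨θ.toMonoidHom, ?_, fun g => DFunLike.congr_fun h g,
    fun i => congrArg AffineGroup.vec (hθ i)⟩
  exact (isOpen_discrete ({1} : Set (AffineGroup (ZMod p) (F ⧸ U.toSubgroup)))).preimage
    θ.continuous_toFun

/-- The linear extension of the j-th crossed homomorphism sends a(τ_i - 1) to a if i = j and to 0
otherwise, so it extracts the coefficient D_j at level U. -/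
theorem IsFreeProPOn.eq_zero_of_sum_mul_eq_zero {X : Type v} [Fintype X] {τ : X → F}
    (hτ : IsFreeProPOn p τ) (D : X → CompletedGroupAlgebra (ZMod p) F)
    (hD : ∑ j, D j * (ofGroup (ZMod p) (τ j) - 1) = 0) : D = 0 := by
  classical
  ext1 j
  refine eq_of_forall_proj_eq _ fun U => ?_
  obtain ⟨θ, hopen, hlin, hvec⟩ := hτ.exists_affine U j
  -- The crossed homomorphism with values in level U is only constant on cosets of this smaller V;
  -- the relation has to be read at level V.
  let V : OpenNormalSubgroup F :=
    { toSubgroup := θ.ker, isOpen' := hopen, isNormal' := inferInstance }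
  have hVU : V ≤ U := fun g hg => by
    have h1 : (QuotientGroup.mk g : F ⧸ U.toSubgroup) = 1 := by
      rw [← hlin, MonoidHom.mem_ker.1 (show g ∈ θ.ker from hg), AffineGroup.one_lin]
    exact (QuotientGroup.eq_one_iff g).1 h1
  let L : MonoidAlgebra (ZMod p) (F ⧸ V.toSubgroup) →+ MonoidAlgebra (ZMod p) (F ⧸ U.toSubgroup) :=
    ((Finsupp.linearCombination (ZMod p)
      fun q : F ⧸ V.toSubgroup => (θ q.out).vec).toAddMonoidHom).comp
      MonoidAlgebra.coeffAddEquiv.toAddMonoidHom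
  have hL : ∀ (g : F) c, L (MonoidAlgebra.single (QuotientGroup.mk g) c) = c • (θ g).vec := by
    intro g c
    have h1 : θ (QuotientGroup.mk g : F ⧸ V.toSubgroup).out = θ g := by
      have h2 := QuotientGroup.eq.1
        (QuotientGroup.out_eq' (QuotientGroup.mk g : F ⧸ V.toSubgroup))
      have h3 := MonoidHom.mem_ker.1 (show _ ∈ θ.ker from h2)
      rwa [map_mul, map_inv, inv_mul_eq_one] at h3
    have h4 : L (MonoidAlgebra.single (QuotientGroup.mk g) c) =
        Finsupp.linearCombination (ZMod p) (fun q : F ⧸ V.toSubgroup => (θ q.out).vec)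
          (Finsupp.single (QuotientGroup.mk g) c) := rfl
    rw [h4, Finsupp.linearCombination_single, h1]
  have hmul : ∀ i a, L (a * (MonoidAlgebra.of (ZMod p) _ (QuotientGroup.mk (τ i)) - 1)) =
      if i = j then transition (ZMod p) hVU a else 0 := by
    intro i a
    induction a using MonoidAlgebra.induction_linear with
    | zero => simp
    | add x y hx hy =>
      rw [add_mul, map_add, hx, hy, map_add]
      split_ifs <;> simp
    | single q c =>
      obtain ⟨g, rfl⟩ := QuotientGroup.mk_surjective q
      rw [mul_sub, mul_one, MonoidAlgebra.of_apply, MonoidAlgebra.single_mul_single, mul_one,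
        ← QuotientGroup.mk_mul, map_sub, hL, hL, map_mul, AffineGroup.mul_vec, hlin, hvec,
        smul_add, add_sub_cancel_left, transition_single]
      split_ifs
      · rw [mul_one, MonoidAlgebra.of_apply, MonoidAlgebra.smul_single, smul_eq_mul, mul_one]
      · rw [mul_zero, smul_zero]
  have h := congrArg (fun b => L (proj (ZMod p) V b)) hD
  simp only [map_sum, map_mul, map_sub, map_one, proj_ofGroup, hmul, map_zero,
    Finset.sum_ite_eq', Finset.mem_univ, if_true, transition_proj] at h
  rw [h, Pi.zero_apply, map_zero]

/-- A family of the size of a free basis that generates the augmentation ideal freely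
generates it. -/
theorem eq_zero_of_sum_mul_eq_zero_of_span {d : ℕ} {τ : Fin d → F} (hτ : IsFreeProPOn p τ)
    {y : Fin d → CompletedGroupAlgebra (ZMod p) F}
    (hy : augIdeal (ZMod p) F = Ideal.span (Set.range y))
    (D : Fin d → CompletedGroupAlgebra (ZMod p) F) (hD : ∑ j, D j * y j = 0) : D = 0 := by
  have : IsTopologicalGroup F := IsProP.toIsTopologicalGroup p
  have : CompactSpace F := IsProP.toCompactSpace p
  have hI := augIdeal_eq_span_of_isFreeProPOn hτ
  have hA : ∀ j, ∃ A : Fin d → CompletedGroupAlgebra (ZMod p) F,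
      ∑ i, A i * (ofGroup (ZMod p) (τ i) - 1) = y j := fun j => by
    refine mem_span_range_iff.1 ?_
    rw [← hI, hy]
    exact Ideal.subset_span ⟨j, rfl⟩
  have hB : ∀ i, ∃ B : Fin d → CompletedGroupAlgebra (ZMod p) F,
      ∑ j, B j * y j = ofGroup (ZMod p) (τ i) - 1 := fun i => by
    refine mem_span_range_iff.1 ?_
    rw [← hy]
    exact ofGroup_sub_one_mem _ _
  choose A hA using hA
  choose B hB using hB
  have hassoc : ∀ E : Fin d → CompletedGroupAlgebra (ZMod p) F,
      ∑ j, E j * y j = ∑ i, Matrix.vecMul E (Matrix.of A) i * (ofGroup (ZMod p) (τ i) - 1) := by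
    intro E
    simp only [← hA, Matrix.vecMul, dotProduct, Finset.mul_sum, Finset.sum_mul, ← mul_assoc,
      Matrix.of_apply]
    exact Finset.sum_comm
  have hBA : Matrix.of B * Matrix.of A = 1 := by
    refine Matrix.ext fun i j => congrFun (sub_eq_zero.1 (hτ.eq_zero_of_sum_mul_eq_zero
      ((Matrix.of B * Matrix.of A) i - (1 : Matrix (Fin d) (Fin d) _) i) ?_)) j
    have h1 := hassoc (B i)
    rw [hB] at h1
    simp only [Pi.sub_apply, sub_mul, Finset.sum_sub_distrib, Matrix.one_apply, ite_mul, one_mul,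
      zero_mul, Finset.sum_ite_eq, Finset.mem_univ, if_true]
    rw [h1, sub_eq_zero]
    rfl
  -- At each level the matrices have entries in a finite ring, where a one-sided inverse is
  -- two-sided.
  have hAB : Matrix.of A * Matrix.of B = 1 := by
    refine Matrix.ext fun i j => ?_
    refine eq_of_forall_proj_eq _ fun U => ?_
    have h1 := congrArg (fun M => M.map (proj (ZMod p) U)) hBA
    simp only [Matrix.map_mul, Matrix.map_one _ (map_zero (proj (ZMod p) U))
      (map_one (proj (ZMod p) U))] at h1
    have h2 := mul_eq_one_comm.1 h1
    have h3 := congrFun (congrFun h2 i) j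
    rw [← Matrix.map_mul, Matrix.map_apply] at h3
    rw [h3, Matrix.one_apply, Matrix.one_apply]
    split_ifs <;> simp
  have hDA : Matrix.vecMul D (Matrix.of A) = 0 :=
    hτ.eq_zero_of_sum_mul_eq_zero _ ((hassoc D).symm.trans hD)
  rw [← Matrix.vecMul_one D, ← hAB, ← Matrix.vecMul_vecMul, hDA, Matrix.zero_vecMul]

end Free

/-- The span of `v` has dimension equal to the size of the index set, which bounds the dimension of
the span of `w`; so the two spans coincide. -/
theorem _root_.LinearIndependent.mem_span_of_forall_mem_span {k V ι : Type*} [Field k]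
    [AddCommGroup V] [Module k V] [Fintype ι] {v w : ι → V} (hv : LinearIndependent k v)
    (hvw : ∀ j, v j ∈ Submodule.span k (Set.range w)) (i : ι) :
    w i ∈ Submodule.span k (Set.range v) := by
  have : FiniteDimensional k (Submodule.span k (Set.range w)) :=
    FiniteDimensional.span_of_finite _ (Set.finite_range w)
  have heq : Submodule.span k (Set.range v) = Submodule.span k (Set.range w) := by
    refine Submodule.eq_of_le_of_finrank_le (Submodule.span_le.2 ?_) ?_
    · rintro _ ⟨j, rfl⟩
      exact hvw j
    · rw [finrank_span_eq_card hv]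
      exact finrank_range_le_card w
  rw [heq]
  exact Submodule.subset_span ⟨i, rfl⟩

/-- If `x` generates `I` and a family `y` of the same size in `I` is linearly independent modulo
`I^2`, then `y` generates `I` modulo `I^2`. -/
theorem le_span_sup_sq {k R ι : Type*} [Field k] [Ring R] [Algebra k R] [Fintype ι] {I : Ideal R}
    [I.IsTwoSided] {x y : ι → R} (hI : I = Ideal.span (Set.range x))
    (hk : ∀ b : R, ∃ c : k, b - algebraMap k R c ∈ I) (hy : ∀ j, y j ∈ I)
    (hli : ∀ c : ι → k, ∑ j, c j • y j ∈ I ^ 2 → c = 0) :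
    I ≤ Ideal.span (Set.range y) ⊔ I ^ 2 := by
  let π := (I ^ 2).mkQ.restrictScalars k
  have hπ : ∀ b, π b = 0 ↔ b ∈ I ^ 2 := fun b => Submodule.Quotient.mk_eq_zero _
  have hx : ∀ i, x i ∈ I := fun i => by rw [hI]; exact Ideal.subset_span ⟨i, rfl⟩
  have hsum : ∀ (z : ι → R) (c : ι → k), π (∑ j, c j • z j) = ∑ j, c j • π (z j) := fun z c =>
    (map_sum π _ _).trans (Finset.sum_congr rfl fun j _ => map_smul π _ _)
  have hv : LinearIndependent k fun j => π (y j) := by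
    rw [Fintype.linearIndependent_iff]
    intro c hc
    exact congrFun (hli c ((hπ _).1 ((hsum y c).trans hc)))
  have hvw : ∀ j, π (y j) ∈ Submodule.span k (Set.range fun i => π (x i)) := by
    intro j
    have h1 := hy j
    rw [hI] at h1
    obtain ⟨B, hB⟩ := mem_span_range_iff.1 h1
    choose c hc using fun i => hk (B i)
    refine (Submodule.mem_span_range_iff_exists_fun _).2 ⟨c, ?_⟩
    rw [← hsum, ← sub_eq_zero, ← map_sub, hπ]
    -- Replacing each coefficient by its residue in k changes the sum by an element of I · I.
    have h2 : ∑ i, c i • x i - y j = -∑ i, (B i - algebraMap k _ (c i)) * x i := by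
      rw [← hB, ← Finset.sum_sub_distrib, ← Finset.sum_neg_distrib]
      refine Finset.sum_congr rfl fun i _ => ?_
      rw [sub_mul, neg_sub, Algebra.smul_def]
    rw [h2, Submodule.pow_succ, Submodule.pow_one]
    exact neg_mem (sum_mem fun i _ => Submodule.mul_mem_mul (hc i) (hx i))
  conv_lhs => rw [hI]
  rw [Ideal.span_le]
  rintro _ ⟨i, rfl⟩
  obtain ⟨c, hc⟩ := (Submodule.mem_span_range_iff_exists_fun _).1
    (hv.mem_span_of_forall_mem_span hvw i)
  have h1 : x i - ∑ j, c j • y j ∈ I ^ 2 := by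
    rw [← hπ, map_sub, hsum, hc, sub_self]
  rw [SetLike.mem_coe, ← add_sub_cancel (∑ j, c j • y j) (x i)]
  exact add_mem (Ideal.mem_sup_left (sum_mem fun j _ =>
    Submodule.smul_of_tower_mem _ _ (Ideal.subset_span ⟨j, rfl⟩))) (Ideal.mem_sup_right h1)

/-! ### Functoriality and lifts of generators -/

section Lifts

variable {p : ℕ} [Fact p.Prime] {F : Type u} [Group F] [TopologicalSpace F]
  {G : Type v} [Group G] [TopologicalSpace G] (φ : F →ₜ* G)

theorem proj_mapCompleted (k : Type w) [CommRing k] (U : OpenNormalSubgroup G)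
    (b : CompletedGroupAlgebra k F) :
    proj k U (mapCompleted k φ b) = componentMap k φ U (proj k (comapOpen φ U) b) := rfl

theorem mapCompleted_ofGroup (k : Type w) [CommRing k] (g : F) :
    mapCompleted k φ (ofGroup k g) = ofGroup k (φ g) := by
  refine eq_of_forall_proj_eq _ fun U => ?_
  rw [proj_mapCompleted, proj_ofGroup, proj_ofGroup, MonoidAlgebra.of_apply, componentMap,
    MonoidAlgebra.mapDomainAlgHom_apply, MonoidAlgebra.mapDomain_single]
  rfl

theorem mapCompleted_mem (k : Type w) [CommRing k] {b : CompletedGroupAlgebra k F}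
    (hb : b ∈ augIdeal k F) : mapCompleted k φ b ∈ augIdeal k G := by
  rw [RingHom.mem_ker, augmentation_apply k (wholeGroup F)] at hb
  rw [RingHom.mem_ker, augmentation_apply k (wholeGroup G), proj_mapCompleted, ← hb]
  have : proj k (wholeGroup F) b = proj k (comapOpen φ (wholeGroup G)) b := rfl
  rw [this]
  generalize proj k (comapOpen φ (wholeGroup G)) b = a
  change MonoidAlgebra.lift k k (G ⧸ (wholeGroup G).toSubgroup) 1 _ =
    MonoidAlgebra.lift k k (F ⧸ (comapOpen φ (wholeGroup G)).toSubgroup) 1 a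
  induction a using MonoidAlgebra.induction_linear with
  | zero => simp
  | add x y hx hy => rw [map_add, map_add, map_add, hx, hy]
  | single q c =>
    rw [componentMap, MonoidAlgebra.mapDomainAlgHom_apply, MonoidAlgebra.mapDomain_single,
      MonoidAlgebra.lift_single, MonoidAlgebra.lift_single]
    rfl

theorem mapCompleted_mem_pow (k : Type w) [CommRing k] (n : ℕ) {b : CompletedGroupAlgebra k F}
    (hb : b ∈ augIdeal k F ^ n) : mapCompleted k φ b ∈ augIdeal k G ^ n := by
  induction n generalizing b with
  | zero =>
    rw [Submodule.pow_zero, Ideal.one_eq_top]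
    trivial
  | succ n ih =>
    rw [Submodule.pow_succ] at hb ⊢
    refine Submodule.mul_induction_on hb (fun a ha i hi => ?_) (fun a b ha hb => ?_)
    · rw [map_mul]
      exact Submodule.mul_mem_mul (ih ha) (mapCompleted_mem φ k hi)
    · rw [map_add]
      exact add_mem ha hb

variable [IsProP p F] [IsProP p G]

/-- Lifts of a minimal generating system of `G` generate the augmentation ideal of `F`. -/
theorem augIdeal_eq_span_of_isMinimalGenerating {d : ℕ} {τ : Fin d → F} (hτ : IsFreeProPOn p τ)
    {σ : Fin d → F} (hσ : IsMinimalGenerating fun j => φ (σ j)) :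
    augIdeal (ZMod p) F = Ideal.span (Set.range (foxVar p σ)) := by
  have hI := augIdeal_eq_span_of_isFreeProPOn hτ
  apply le_antisymm
  · refine augIdeal_le_of_le_sup_sq (Submodule.fg_span (Set.finite_range _)) ?_
    refine le_span_sup_sq hI exists_sub_algebraMap_mem (fun j => ofGroup_sub_one_mem _ _)
      fun c hc => linearIndependent_of_isMinimalGenerating p hσ c ?_
    -- A linear relation modulo I_F² between the σ_j - 1 maps to one in G, where minimality forbids
    -- it.
    have h2 := mapCompleted_mem_pow φ (ZMod p) 2 hc
    simpa only [map_sum, map_smul, foxVar, map_sub, map_one, mapCompleted_ofGroup] using h2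
  · rw [Ideal.span_le]
    rintro _ ⟨j, rfl⟩
    exact ofGroup_sub_one_mem _ _

end Lifts

/-! ### The kernel of the map of completed group algebras -/

section Kernel

variable {p : ℕ} [Fact p.Prime] {F : Type u} [Group F] [TopologicalSpace F]
  {G : Type v} [Group G] [TopologicalSpace G] {φ : F →ₜ* G}
  {ι : Type*} [Fintype ι] {x : ι → CompletedGroupAlgebra (ZMod p) F}

theorem exists_proj_mapCompleted_eq (hφ : Function.Surjective φ) (U : OpenNormalSubgroup G)
    (a : MonoidAlgebra (ZMod p) (G ⧸ U.toSubgroup)) :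
    ∃ z, proj (ZMod p) U (mapCompleted (ZMod p) φ z) = a := by
  induction a using MonoidAlgebra.induction_linear with
  | zero => exact ⟨0, by rw [map_zero, map_zero]⟩
  | add x y hx hy =>
    obtain ⟨x, rfl⟩ := hx
    obtain ⟨y, rfl⟩ := hy
    exact ⟨x + y, by rw [map_add, map_add]⟩
  | single q c =>
    obtain ⟨g, rfl⟩ := QuotientGroup.mk_surjective q
    obtain ⟨h, rfl⟩ := hφ g
    refine ⟨c • ofGroup _ h, ?_⟩
    rw [map_smul, map_smul, mapCompleted_ofGroup, proj_ofGroup, MonoidAlgebra.of_apply,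
      MonoidAlgebra.smul_single, smul_eq_mul, mul_one]

/-- The map `I_F^n → I_G^n` is surjective at every finite level. -/
theorem exists_mem_pow_proj_mapCompleted_eq (hφ : Function.Surjective φ)
    (hxF : ∀ j, x j ∈ augIdeal (ZMod p) F)
    (hG : augIdeal (ZMod p) G = Ideal.span (Set.range fun j => mapCompleted (ZMod p) φ (x j)))
    (U : OpenNormalSubgroup G) (n : ℕ) {y : CompletedGroupAlgebra (ZMod p) G}
    (hy : y ∈ augIdeal (ZMod p) G ^ n) :
    ∃ z ∈ augIdeal (ZMod p) F ^ n,
      proj (ZMod p) U (mapCompleted (ZMod p) φ z) = proj (ZMod p) U y := by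
  induction n generalizing y with
  | zero =>
    obtain ⟨z, hz⟩ := exists_proj_mapCompleted_eq hφ U (proj (ZMod p) U y)
    refine ⟨z, ?_, hz⟩
    rw [Submodule.pow_zero, Ideal.one_eq_top]
    trivial
  | succ n ih =>
    obtain ⟨B, hB, rfl⟩ := (mem_pow_succ_iff hG n).1 hy
    choose C hC hCB using fun j => ih (hB j)
    refine ⟨∑ j, C j * x j, ?_, ?_⟩
    · rw [Submodule.pow_succ]
      exact sum_mem fun j _ => Submodule.mul_mem_mul (hC j) (hxF j)
    · simp only [map_sum, map_mul, hCB]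

theorem exists_mapCompleted_sub_mem [IsProP p G] (hφ : Function.Surjective φ)
    (hG : augIdeal (ZMod p) G = Ideal.span (Set.range fun j => mapCompleted (ZMod p) φ (x j)))
    (n : ℕ) (y : CompletedGroupAlgebra (ZMod p) G) :
    ∃ z, mapCompleted (ZMod p) φ z - y ∈ augIdeal (ZMod p) G ^ n := by
  obtain ⟨U, hU⟩ := exists_ker_proj_le hG n
  obtain ⟨z, hz⟩ := exists_proj_mapCompleted_eq hφ U (proj (ZMod p) U y)
  exact ⟨z, hU _ (by rw [map_sub, hz, sub_self])⟩

/-- The image of an open normal subgroup under a surjective open homomorphism. -/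
def mapOpen (hφ : Function.Surjective φ) (hopen : IsOpenMap φ) (W : OpenNormalSubgroup F) :
    OpenNormalSubgroup G where
  toSubgroup := W.toSubgroup.map φ.toMonoidHom
  isOpen' := hopen _ W.isOpen'
  isNormal' := W.isNormal'.map _ hφ

/-- The preimage of `I_G^n` in `𝔽_p[[F]]` is generated, as a left ideal, by `I_F^n` and the
elements `r - 1` with `φ r = 1`. -/
theorem mem_of_mapCompleted_mem_pow [IsProP p F] [IsProP p G] (hφ : Function.Surjective φ)
    (hF : augIdeal (ZMod p) F = Ideal.span (Set.range x))
    (hG : augIdeal (ZMod p) G = Ideal.span (Set.range fun j => mapCompleted (ZMod p) φ (x j)))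
    (n : ℕ) {N : Ideal (CompletedGroupAlgebra (ZMod p) F)} (hN : augIdeal (ZMod p) F ^ n ≤ N)
    (hker : ∀ g, φ g = 1 → ofGroup (ZMod p) g - 1 ∈ N) {b : CompletedGroupAlgebra (ZMod p) F}
    (hb : mapCompleted (ZMod p) φ b ∈ augIdeal (ZMod p) G ^ n) : b ∈ N := by
  have : IsTopologicalGroup F := IsProP.toIsTopologicalGroup p
  have : CompactSpace F := IsProP.toCompactSpace p
  have : IsTopologicalGroup G := IsProP.toIsTopologicalGroup p
  have : T2Space G := IsProP.toT2Space p
  -- From a compact to a Hausdorff group φ is closed, hence a quotient map, hence open; so the image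
  -- of `W` below is open.
  have hopen : IsOpenMap φ := (MonoidHom.isOpenQuotientMap_of_isQuotientMap
    (φ.continuous_toFun.isClosedMap.isQuotientMap φ.continuous_toFun hφ)).isOpenMap
  obtain ⟨W, hW⟩ := exists_ker_proj_le hF n
  let U := mapOpen hφ hopen W
  have hWU : W ≤ comapOpen φ U := fun g hg => ⟨g, hg, rfl⟩
  have hxF : ∀ j, x j ∈ augIdeal (ZMod p) F := fun j => by
    rw [hF]; exact Ideal.subset_span ⟨j, rfl⟩
  obtain ⟨c, hc, hcb⟩ := exists_mem_pow_proj_mapCompleted_eq hφ hxF hG U n hb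
  -- The preimage of φ(W) is W · ker φ, so everything lost on the way from level W of F to level
  -- φ(W) of G is already lost in passing to that preimage.
  have hinj : Function.Injective (componentMap (ZMod p) φ U) := by
    have : Function.Injective (QuotientGroup.map (comapOpen φ U).toSubgroup U.toSubgroup
        φ.toMonoidHom (fun _ hx => hx)) := by
      rw [injective_iff_map_eq_one]
      intro q hq
      obtain ⟨g, rfl⟩ := QuotientGroup.mk_surjective q
      exact (QuotientGroup.eq_one_iff g).2 ((QuotientGroup.eq_one_iff (φ g)).1 hq)
    exact MonoidAlgebra.mapDomain_injective this
  rw [proj_mapCompleted, proj_mapCompleted] at hcb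
  have h0 : transition (ZMod p) hWU (proj (ZMod p) W (b - c)) = 0 := by
    rw [transition_proj, map_sub, hinj hcb, sub_self]
  have hsurj := proj_surjective (ZMod p) W
  have h1 : proj (ZMod p) W (b - c) ∈ N.map (proj (ZMod p) W) := by
    refine mem_of_transition_eq_zero (ZMod p) hWU _ (fun g hg => ?_) h0
    obtain ⟨w, hw, hwg⟩ := hg
    -- Modulo W, an element of W · ker φ can be replaced by one of ker φ.
    have hk : φ (g * w⁻¹) = 1 := by
      rw [map_mul, map_inv, mul_inv_eq_one]
      exact hwg.symm
    have h2 := Ideal.mem_map_of_mem (proj (ZMod p) W) (hker _ hk)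
    have h3 : (QuotientGroup.mk (g * w⁻¹) : F ⧸ W.toSubgroup) = QuotientGroup.mk g := by
      rw [QuotientGroup.mk_mul, (QuotientGroup.eq_one_iff w⁻¹).2 (inv_mem hw), mul_one]
    rwa [map_sub, map_one, proj_ofGroup, h3] at h2
  obtain ⟨e, he, hec⟩ := (Ideal.mem_map_iff_of_surjective (proj (ZMod p) W) hsurj).1 h1
  have h4 : b - c - e ∈ augIdeal (ZMod p) F ^ n := hW _ (by rw [map_sub, hec, sub_self])
  have h5 : b = (b - c - e) + c + e := by abel
  rw [h5]
  exact add_mem (add_mem (hN h4) (hN hc)) he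

end Kernel

/-! ### Fox derivatives, levels and the truncated Jacobian -/

section FoxCalculus

variable {p : ℕ} {F : Type u} [Group F] [TopologicalSpace F] {d : ℕ} {σ : Fin d → F}

theorem existsUnique_fox
    (hF : augIdeal (ZMod p) F = Ideal.span (Set.range (foxVar p σ)))
    (hfree : ∀ D : Fin d → CompletedGroupAlgebra (ZMod p) F, ∑ j, D j * foxVar p σ j = 0 → D = 0)
    {f : CompletedGroupAlgebra (ZMod p) F} (hf : f ∈ augIdeal (ZMod p) F) :
    ∃! D : Fin d → CompletedGroupAlgebra (ZMod p) F, f = ∑ j, D j * foxVar p σ j := by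
  rw [hF] at hf
  obtain ⟨D, hD⟩ := mem_span_range_iff.1 hf
  refine ⟨D, hD.symm, fun E hE => ?_⟩
  refine sub_eq_zero.1 (hfree _ ?_)
  simp only [Pi.sub_apply, sub_mul, Finset.sum_sub_distrib, hD, ← hE, sub_self]

theorem sum_foxDeriv_mul {f : CompletedGroupAlgebra (ZMod p) F}
    (hf : ∃! D : Fin d → CompletedGroupAlgebra (ZMod p) F, f = ∑ j, D j * foxVar p σ j) :
    ∑ j, foxDeriv p σ f j * foxVar p σ j = f := by
  rw [foxDeriv, dif_pos hf]
  exact hf.exists.choose_spec.symm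

theorem foxDeriv_mem_pow
    (hF : augIdeal (ZMod p) F = Ideal.span (Set.range (foxVar p σ)))
    {f : CompletedGroupAlgebra (ZMod p) F}
    (hf : ∃! D : Fin d → CompletedGroupAlgebra (ZMod p) F, f = ∑ j, D j * foxVar p σ j)
    {n : ℕ} (hn : f ∈ augIdeal (ZMod p) F ^ (n + 1)) (j : Fin d) :
    foxDeriv p σ f j ∈ augIdeal (ZMod p) F ^ n := by
  obtain ⟨D, hD, hDf⟩ := (mem_pow_succ_iff hF n).1 hn
  rw [hf.unique (sum_foxDeriv_mul hf).symm hDf.symm]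
  exact hD j

theorem level_eq {f : CompletedGroupAlgebra (ZMod p) F} {n : ℕ}
    (h1 : f ∈ augIdeal (ZMod p) F ^ n) (h2 : f ∉ augIdeal (ZMod p) F ^ (n + 1)) :
    level p f = n := by
  have hub : n ∈ upperBounds {m | f ∈ augIdeal (ZMod p) F ^ m} := fun m hm => by
    by_contra hlt
    exact h2 (pow_le_pow (Nat.lt_of_not_le hlt) hm)
  exact le_antisymm (csSup_le ⟨n, h1⟩ hub) (le_csSup ⟨n, hub⟩ h1)

variable {G : Type v} [Group G] [TopologicalSpace G] {φ : F →ₜ* G}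

theorem jacobianRowMod_apply (f : CompletedGroupAlgebra (ZMod p) F) (n : ℕ)
    (b : CompletedGroupAlgebra (ZMod p) G) (j : Fin d) :
    jacobianRowMod p φ σ f n b j =
      Submodule.Quotient.mk (b * mapCompleted (ZMod p) φ (foxDeriv p σ f j)) := rfl

theorem rowDescends (hF : augIdeal (ZMod p) F = Ideal.span (Set.range (foxVar p σ)))
    {f : CompletedGroupAlgebra (ZMod p) F}
    (hf : ∃! D : Fin d → CompletedGroupAlgebra (ZMod p) F, f = ∑ j, D j * foxVar p σ j)
    {k : ℕ} (hk : 1 ≤ k) (hfk : f ∈ augIdeal (ZMod p) F ^ k) (hlevel : level p f = k) (n : ℕ) :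
    RowDescends p φ σ f n := by
  intro b hb
  rw [hlevel] at hb
  obtain ⟨l, rfl⟩ := Nat.exists_eq_add_of_le' hk
  rw [LinearMap.mem_ker]
  ext1 j
  rw [jacobianRowMod_apply, Pi.zero_apply, Submodule.Quotient.mk_eq_zero]
  have h1 := mapCompleted_mem_pow φ (ZMod p) l (foxDeriv_mem_pow hF hf hfk j)
  have h2 := Submodule.mul_mem_mul hb h1
  -- Truncated subtraction is harmless: for n ≤ l + 1 the first exponent is 0, and I^l alone is
  -- contained in I^(n-1).
  refine pow_le_pow (show n - 1 ≤ n - (l + 1) + l by omega) ?_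
  rw [Ideal.IsTwoSided.pow_add]
  exact h2

theorem truncatedJacobian_of {A : Type w} [DecidableEq A]
    (f : A → CompletedGroupAlgebra (ZMod p) F) {n : ℕ} {a : A} (h : RowDescends p φ σ (f a) n)
    (b : CompletedGroupAlgebra (ZMod p) G) :
    truncatedJacobian p φ σ f n (DirectSum.lof (CompletedGroupAlgebra (ZMod p) G) A
      (fun a => CompletedGroupAlgebra (ZMod p) G ⧸ augIdeal (ZMod p) G ^ (n - level p (f a))) a
      (Submodule.Quotient.mk b)) = jacobianRowMod p φ σ (f a) n b := by
  rw [truncatedJacobian, DirectSum.toModule_lof, truncatedRow, dif_pos h]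
  rfl

end FoxCalculus

/-! ### Exact levels of minimal relations -/

section Relations

variable {p : ℕ} {F : Type u} [Group F] [TopologicalSpace F] {R : Subgroup F} {r : ℕ → ℕ}
  {ρ : (Σ k : ℕ, Fin (r k)) → F}

theorem IsMinimalRelationSystem.one_le (hρ : IsMinimalRelationSystem p R r ρ)
    (a : Σ k : ℕ, Fin (r k)) : 1 ≤ a.1 := by
  obtain ⟨k, i⟩ := a
  rcases Nat.eq_zero_or_pos k with rfl | hk
  · have h0 : r 0 = 0 := hρ.count_zero
    exact absurd i.2 (by omega)
  · exact hk

/-- If ρ_a lay one step deeper, it would be trivial modulo F_{k+1}, where k is its level, and could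
be dropped from the system for n = k. -/
theorem IsMinimalRelationSystem.notMem_zassenhaus
    (hρ : IsMinimalRelationSystem p R r ρ) (a : Σ k : ℕ, Fin (r k)) :
    ρ a ∉ zassenhaus p F (a.1 + 1) := by
  intro ha
  have hssub : {b : Σ k : ℕ, Fin (r k) | b.1 ≤ a.1} \ {a} ⊂ {b | b.1 ≤ a.1} :=
    ⟨Set.sdiff_subset, fun h => (h (show a.1 ≤ a.1 from le_rfl)).2 rfl⟩
  refine hρ.minimal a.1 (hρ.one_le a) _ hssub ?_
  rw [← hρ.generates a.1 (hρ.one_le a)]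
  apply le_antisymm
  · exact sup_le_sup_right (Subgroup.normalClosure_mono (Set.image_mono hssub.1)) _
  · have hnormal : (zassenhaus p F (a.1 + 1)).Normal := ⟨fun g hg h => by
      change ofGroup (ZMod p) (h * g * h⁻¹) - 1 ∈ augIdeal (ZMod p) F ^ (a.1 + 1)
      have h1 : ofGroup (ZMod p) (h * g * h⁻¹) - 1 =
          ofGroup (ZMod p) h * (ofGroup (ZMod p) g - 1) * ofGroup (ZMod p) h⁻¹ := by
        rw [mul_sub, sub_mul, mul_one, ← map_mul, ← map_mul, ← map_mul, mul_inv_cancel, map_one]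
      rw [h1]
      exact Ideal.mul_mem_right _ _ (Ideal.mul_mem_left _ _ hg)⟩
    refine sup_le (Subgroup.normalClosure_le_normal ?_) le_sup_right
    rintro _ ⟨b, hb, rfl⟩
    by_cases hba : b = a
    · rw [hba]
      exact Subgroup.mem_sup_right ha
    · exact Subgroup.mem_sup_left (Subgroup.subset_normalClosure ⟨b, ⟨hb, hba⟩, rfl⟩)

end Relations

set_option synthInstance.maxHeartbeats 200000
set_option maxHeartbeats 1000000

open scoped DirectSum

/-! ### Exactness of the truncated Fox sequence -/

section Exactness

variable {p : ℕ} {F : Type u} [Group F] [TopologicalSpace F]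
  {G : Type v} [Group G] [TopologicalSpace G] {d : ℕ} (σ : Fin d → F) (φ : F →ₜ* G)

theorem mapCompleted_foxVar_mem (j : Fin d) :
    mapCompleted (ZMod p) φ (foxVar p σ j) ∈ augIdeal (ZMod p) G :=
  mapCompleted_mem φ (ZMod p) (ofGroup_sub_one_mem _ _)

/-- The map `(g_j) ↦ ∑ g_j x_j` from `⨁ 𝔽_p[[G]] / I^(n-1)` to `𝔽_p[[G]] / I^n`. -/
noncomputable def foxSum (p : ℕ) {F : Type u} [Group F] [TopologicalSpace F] {G : Type v}
    [Group G] [TopologicalSpace G] {d : ℕ} (σ : Fin d → F) (φ : F →ₜ* G) (n : ℕ) :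
    (Fin d → CompletedGroupAlgebra (ZMod p) G ⧸ augIdeal (ZMod p) G ^ (n - 1))
      →ₗ[CompletedGroupAlgebra (ZMod p) G]
      (CompletedGroupAlgebra (ZMod p) G ⧸ augIdeal (ZMod p) G ^ n) :=
  ∑ j, (mulRightMod (show n ≤ n - 1 + 1 by omega) (mapCompleted (ZMod p) φ (foxVar p σ j))
    (mapCompleted_foxVar_mem σ φ j)).comp (LinearMap.proj j)

theorem foxSum_mk (n : ℕ) (g : Fin d → CompletedGroupAlgebra (ZMod p) G) :
    foxSum p σ φ n (fun j => Submodule.Quotient.mk (g j)) =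
      Submodule.Quotient.mk (∑ j, g j * mapCompleted (ZMod p) φ (foxVar p σ j)) := by
  rw [foxSum, LinearMap.sum_apply]
  exact (map_sum (augIdeal (ZMod p) G ^ n).mkQ _ _).symm

variable {σ φ}

/-- The composite sends b to b · φ(∑ (∂f/∂x_j) x_j) = b · φ(f). -/
theorem foxSum_jacobianRowMod {f : CompletedGroupAlgebra (ZMod p) F}
    (hf : ∃! D : Fin d → CompletedGroupAlgebra (ZMod p) F, f = ∑ j, D j * foxVar p σ j)
    (hφf : mapCompleted (ZMod p) φ f = 0) (n : ℕ) (b : CompletedGroupAlgebra (ZMod p) G) :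
    foxSum p σ φ n (jacobianRowMod p φ σ f n b) = 0 := by
  refine (foxSum_mk σ φ n _).trans ?_
  have h : ∑ j, b * mapCompleted (ZMod p) φ (foxDeriv p σ f j) *
      mapCompleted (ZMod p) φ (foxVar p σ j) = b * mapCompleted (ZMod p) φ f := by
    conv_rhs => rw [← sum_foxDeriv_mul hf]
    simp only [map_sum, map_mul, Finset.mul_sum, mul_assoc]
  exact (Submodule.Quotient.mk_eq_zero _).2 (by
    change ∑ j, b * mapCompleted (ZMod p) φ (foxDeriv p σ f j) *
      mapCompleted (ZMod p) φ (foxVar p σ j) ∈ _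
    rw [h, hφf, mul_zero]
    exact zero_mem _)

/-- The elements `∑ D_j x_j` for which the images of the `D_j` form an element of `X`. -/
def foxIdeal (σ : Fin d → F) (φ : F →ₜ* G) {m : ℕ}
    (X : Submodule (CompletedGroupAlgebra (ZMod p) G)
      (Fin d → CompletedGroupAlgebra (ZMod p) G ⧸ augIdeal (ZMod p) G ^ m)) :
    Ideal (CompletedGroupAlgebra (ZMod p) F) where
  carrier := {b | ∃ D : Fin d → CompletedGroupAlgebra (ZMod p) F, ∑ j, D j * foxVar p σ j = b ∧
    (fun j => Submodule.Quotient.mk (mapCompleted (ZMod p) φ (D j))) ∈ X}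
  zero_mem' := ⟨0, by simp, by
    convert! X.zero_mem⟩
  add_mem' := by
    rintro _ _ ⟨D, rfl, hD⟩ ⟨E, rfl, hE⟩
    refine ⟨D + E, by simp only [Pi.add_apply, add_mul, Finset.sum_add_distrib], ?_⟩
    convert! X.add_mem hD hE
    rw [Pi.add_apply, map_add]
    rfl
  smul_mem' := by
    rintro b _ ⟨D, rfl, hD⟩
    refine ⟨fun j => b * D j, by simp only [smul_eq_mul, Finset.mul_sum, mul_assoc], ?_⟩
    convert! X.smul_mem (mapCompleted (ZMod p) φ b) hD
    rw [map_mul]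
    rfl

/-- The coefficients of (g - 1)i are (g - 1) times those of i, and φ kills g - 1. -/
theorem sub_one_mul_mem_foxIdeal
    (hF : augIdeal (ZMod p) F = Ideal.span (Set.range (foxVar p σ)))
    {m : ℕ} (X : Submodule (CompletedGroupAlgebra (ZMod p) G)
      (Fin d → CompletedGroupAlgebra (ZMod p) G ⧸ augIdeal (ZMod p) G ^ m))
    {g : F} (hg : φ g = 1) {i : CompletedGroupAlgebra (ZMod p) F} (hi : i ∈ augIdeal (ZMod p) F) :
    (ofGroup (ZMod p) g - 1) * i ∈ foxIdeal σ φ X := by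
  rw [hF] at hi
  obtain ⟨E, rfl⟩ := mem_span_range_iff.1 hi
  refine ⟨fun j => (ofGroup (ZMod p) g - 1) * E j, by simp only [mul_assoc, Finset.mul_sum], ?_⟩
  have h : ∀ j, mapCompleted (ZMod p) φ ((ofGroup (ZMod p) g - 1) * E j) = 0 := fun j => by
    rw [map_mul, map_sub, map_one, mapCompleted_ofGroup, hg, map_one, sub_self, zero_mul]
  simp only [h]
  exact X.zero_mem

variable {r : ℕ → ℕ} {ρ : (Σ k : ℕ, Fin (r k)) → F}

/-- A left ideal that contains `I^(m+1)`, the `ρ - 1`, and the products `(g - 1) i` for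
`φ g = 1`, `i ∈ I`, contains all `g - 1` with `φ g = 1`. -/
theorem IsMinimalRelationSystem.sub_one_mem
    (hρ : IsMinimalRelationSystem p φ.toMonoidHom.ker r ρ)
    {m : ℕ} (N : Ideal (CompletedGroupAlgebra (ZMod p) F))
    (hN : augIdeal (ZMod p) F ^ (m + 1) ≤ N) (hρN : ∀ a, ofGroup (ZMod p) (ρ a) - 1 ∈ N)
    (hmul : ∀ g, φ g = 1 → ∀ i ∈ augIdeal (ZMod p) F, (ofGroup (ZMod p) g - 1) * i ∈ N)
    {g : F} (hg : φ g = 1) : ofGroup (ZMod p) g - 1 ∈ N := by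
  -- The relations are assumed to generate only for n ≥ 1; for m = 0 the ideal contains all of I.
  rcases Nat.eq_zero_or_pos m with rfl | hm
  · refine hN ?_
    rw [zero_add, Submodule.pow_one]
    exact ofGroup_sub_one_mem _ _
  -- `N` is only a left ideal. Conjugation needs a multiplication from the right, which `hmul`
  -- supplies for elements of the kernel of φ; hence the intersection.
  obtain ⟨K, hK⟩ : ∃ K : Subgroup F, ∀ g, g ∈ K ↔ ofGroup (ZMod p) g - 1 ∈ N ∧ φ g = 1 :=
    ⟨subOneSubgroup (ofGroup (ZMod p)) N ⊓ φ.toMonoidHom.ker, fun g => Iff.rfl⟩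
  have hnormal : K.Normal := by
    refine ⟨fun g hg h => (hK _).2 ?_⟩
    obtain ⟨hgN, hg1⟩ := (hK g).1 hg
    have h4 : ofGroup (ZMod p) (h * g * h⁻¹) - 1 = ofGroup (ZMod p) h *
        ((ofGroup (ZMod p) g - 1) * (ofGroup (ZMod p) h⁻¹ - 1) + (ofGroup (ZMod p) g - 1)) := by
      rw [mul_sub, mul_one, sub_add_cancel, ← mul_assoc, mul_sub, sub_mul, mul_one, ← map_mul,
        ← map_mul, ← map_mul, mul_inv_cancel, map_one]
    rw [h4]
    refine ⟨Ideal.mul_mem_left _ _ (add_mem (hmul g hg1 _ (ofGroup_sub_one_mem _ _)) hgN), ?_⟩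
    rw [map_mul, map_mul, hg1, mul_one, ← map_mul, mul_inv_cancel, map_one]
  have h1 : Subgroup.normalClosure (ρ '' {a | a.1 ≤ m}) ≤
      subOneSubgroup (ofGroup (ZMod p)) N := by
    have h0 : ρ '' {a | a.1 ≤ m} ⊆ K := by
      rintro _ ⟨a, -, rfl⟩
      exact (hK _).2 ⟨hρN a, hρ.mem a⟩
    exact fun g hg => mem_subOneSubgroup.2 ((hK g).1 (Subgroup.normalClosure_le_normal h0 hg)).1
  have h2 : zassenhaus p F (m + 1) ≤ subOneSubgroup (ofGroup (ZMod p)) N := fun g hg => by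
    have h3 : ofGroup (ZMod p) g - 1 ∈ augIdeal (ZMod p) F ^ (m + 1) := hg
    exact mem_subOneSubgroup.2 (hN h3)
  have hle := sup_le h1 h2
  rw [hρ.generates m hm] at hle
  exact mem_subOneSubgroup.1 (hle (Subgroup.mem_sup_left hg))

variable [Fact p.Prime] [IsProP p F] [IsProP p G]

/-- Exactness of the truncated Fox sequence at `⨁ 𝔽_p[[G]] / I^(n-1)`. -/
theorem mem_of_foxSum_eq_zero (hφ : Function.Surjective φ)
    (hF : augIdeal (ZMod p) F = Ideal.span (Set.range (foxVar p σ)))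
    (hfree : ∀ D : Fin d → CompletedGroupAlgebra (ZMod p) F, ∑ j, D j * foxVar p σ j = 0 → D = 0)
    (hG : augIdeal (ZMod p) G =
      Ideal.span (Set.range fun j => mapCompleted (ZMod p) φ (foxVar p σ j)))
    (hρ : IsMinimalRelationSystem p φ.toMonoidHom.ker r ρ)
    {f : (Σ k : ℕ, Fin (r k)) → CompletedGroupAlgebra (ZMod p) F}
    (hf : ∀ a, f a = ofGroup (ZMod p) (ρ a) - 1) {n : ℕ} (hn : 1 ≤ n)
    (X : Submodule (CompletedGroupAlgebra (ZMod p) G)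
      (Fin d → CompletedGroupAlgebra (ZMod p) G ⧸ augIdeal (ZMod p) G ^ (n - 1)))
    (hX : ∀ a, jacobianRowMod p φ σ (f a) n 1 ∈ X)
    {q : Fin d → CompletedGroupAlgebra (ZMod p) G ⧸ augIdeal (ZMod p) G ^ (n - 1)}
    (hq : foxSum p σ φ n q = 0) : q ∈ X := by
  have hpow : augIdeal (ZMod p) F ^ n ≤ foxIdeal σ φ X := by
    intro b hb
    obtain ⟨D, hD, rfl⟩ := (mem_pow_succ_iff hF (n - 1)).1 (pow_le_pow (by omega) hb)
    refine ⟨D, rfl, ?_⟩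
    convert! X.zero_mem
    exact (Submodule.Quotient.mk_eq_zero _).2 (mapCompleted_mem_pow φ _ _ (hD _))
  have hker : ∀ g, φ g = 1 → ofGroup (ZMod p) g - 1 ∈ foxIdeal σ φ X := by
    intro g hg
    refine hρ.sub_one_mem (foxIdeal σ φ X) (m := n - 1) (by rwa [Nat.sub_add_cancel hn])
      (fun a => ?_) (fun g hg i hi => sub_one_mul_mem_foxIdeal hF X hg hi) hg
    rw [← hf]
    refine ⟨_, sum_foxDeriv_mul (existsUnique_fox hF hfree (by
      rw [hf]; exact ofGroup_sub_one_mem _ _)), ?_⟩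
    convert! hX a using 2 with j
    rw [jacobianRowMod_apply, one_mul]
  have hrep : ∀ j, ∃ b, Submodule.Quotient.mk (mapCompleted (ZMod p) φ b) = q j := by
    intro j
    obtain ⟨y, hy⟩ := Submodule.Quotient.mk_surjective _ (q j)
    obtain ⟨z, hz⟩ := exists_mapCompleted_sub_mem hφ hG (n - 1) y
    exact ⟨z, ((Submodule.Quotient.eq _).2 hz).trans hy⟩
  choose D hD using hrep
  obtain rfl : (fun j => Submodule.Quotient.mk (mapCompleted (ZMod p) φ (D j))) = q := funext hD
  have hmem : mapCompleted (ZMod p) φ (∑ j, D j * foxVar p σ j) ∈ augIdeal (ZMod p) G ^ n := by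
    rw [foxSum_mk, Submodule.Quotient.mk_eq_zero] at hq
    simpa only [map_sum, map_mul] using hq
  obtain ⟨E, hE, hEX⟩ := mem_of_mapCompleted_mem_pow hφ hF hG n hpow hker hmem
  -- Membership in `foxIdeal` only provides some coefficients; freeness identifies them with the
  -- chosen lifts.
  have : E = D := sub_eq_zero.1 (hfree _ (by
    simp only [Pi.sub_apply, sub_mul, Finset.sum_sub_distrib, hE, sub_self]))
  rwa [this] at hEX

end Exactness

/-! ### Dimension counts -/

section Dimensions

/-- The dimension count for an exact sequence `A → B → C → K → 0`. -/
theorem finite_and_finrank_ker_of_exact {K A B C : Type*} [Field K] [AddCommMonoid A]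
    [Module K A] [AddCommGroup B] [Module K B] [AddCommGroup C] [Module K C] [Module.Finite K A]
    [Module.Finite K B] [Module.Finite K C] (J : A →ₗ[K] B) (S : B →ₗ[K] C) (e : C →ₗ[K] K)
    (hJS : LinearMap.range J = LinearMap.ker S) (hSe : LinearMap.range S = LinearMap.ker e)
    (he : Function.Surjective e) :
    Module.Finite K (LinearMap.ker J) ∧ Module.finrank K A + Module.finrank K C =
      1 + Module.finrank K (LinearMap.ker J) + Module.finrank K B := by
  -- The source is only given as an additive monoid; negation is supplied by the scalar -1, so that
  -- rank and nullity can be used.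
  let _ : AddCommGroup A := Module.addCommMonoidToAddCommGroup K
  refine ⟨inferInstance, ?_⟩
  have h1 := J.finrank_range_add_finrank_ker
  have h2 := S.finrank_range_add_finrank_ker
  have h3 := e.finrank_range_add_finrank_ker
  rw [LinearMap.range_eq_top.2 he, finrank_top, Module.finrank_self] at h3
  rw [hJS] at h1
  rw [hSe] at h2
  omega

/-- A direct sum whose terms vanish off a finite set is the direct sum over that set. -/
noncomputable def directSumEquivOfSubsingleton (K : Type*) [Semiring K] {ι : Type*}
    [DecidableEq ι] (M : ι → Type*) [∀ i, AddCommGroup (M i)] [∀ i, Module K (M i)]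
    (s : Finset ι) (hs : ∀ i ∉ s, Subsingleton (M i)) :
    (⨁ i, M i) ≃ₗ[K] ⨁ i : s, M i.1 :=
  LinearEquiv.ofBijective (DFinsupp.subtypeDomainLinearMap (γ := K) (β := M) (fun i => i ∈ s)) (by
    constructor
    · rw [injective_iff_map_eq_zero]
      intro x hx
      refine DFinsupp.ext fun i => ?_
      by_cases hi : i ∈ s
      · exact DFunLike.congr_fun hx ⟨i, hi⟩
      · have := hs i hi
        exact Subsingleton.elim _ _
    · intro y
      refine ⟨DFinsupp.mk s fun i => y i, DFinsupp.ext fun i => ?_⟩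
      exact (DFinsupp.mk_of_mem i.2))

/-- There may be infinitely many relations in all, but only the finitely many of level below n
contribute to the source of J_n. -/
theorem finrank_directSum_sigma (K : Type*) [Field K] {r : ℕ → ℕ} (n : ℕ)
    (M : (Σ k : ℕ, Fin (r k)) → Type*) [∀ i, AddCommGroup (M i)] [∀ i, Module K (M i)]
    [∀ i, Module.Finite K (M i)] (hs : ∀ a, n ≤ a.1 → Subsingleton (M a)) (c : ℕ → ℕ)
    (hc : ∀ a, Module.finrank K (M a) = c a.1) :
    Module.Finite K (⨁ a, M a) ∧
      Module.finrank K (⨁ a, M a) = ∑ k ∈ Finset.range n, r k * c k := by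
  let s : Finset (Σ k : ℕ, Fin (r k)) := (Finset.range n).sigma fun k => Finset.univ
  let e := directSumEquivOfSubsingleton K M s fun a ha => hs a (by
    by_contra hlt
    exact ha (Finset.mem_sigma.2 ⟨Finset.mem_range.2 (Nat.lt_of_not_le hlt), Finset.mem_univ _⟩))
  refine ⟨Module.Finite.equiv e.symm, ?_⟩
  rw [e.finrank_eq, Module.finrank_directSum]
  simp only [hc]
  rw [Finset.sum_coe_sort s (fun a => c a.1), Finset.sum_sigma]
  simp

end Dimensions

/-! ### The augmentation modulo a power of the augmentation ideal -/

section Augmentation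

variable (p : ℕ) (G : Type v) [Group G] [TopologicalSpace G]

/-- The augmentation on `𝔽_p[[G]] / I^n` for `n ≥ 1`. -/
noncomputable def augmentationMod {n : ℕ} (hn : 1 ≤ n) :
    (CompletedGroupAlgebra (ZMod p) G ⧸ augIdeal (ZMod p) G ^ n) →ₗ[ZMod p] ZMod p :=
  (Submodule.liftQ ((augIdeal (ZMod p) G ^ n).restrictScalars (ZMod p))
    (augmentation (ZMod p) G).toLinearMap fun b hb => by
      have : b ∈ augIdeal (ZMod p) G ^ 1 := pow_le_pow hn hb
      rw [Submodule.pow_one] at this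
      exact this).comp
  (Submodule.Quotient.restrictScalarsEquiv (ZMod p) (augIdeal (ZMod p) G ^ n)).symm.toLinearMap

theorem augmentationMod_mk {n : ℕ} (hn : 1 ≤ n) (b : CompletedGroupAlgebra (ZMod p) G) :
    augmentationMod p G hn (Submodule.Quotient.mk b) = augmentation (ZMod p) G b := rfl

theorem augmentationMod_surjective {n : ℕ} (hn : 1 ≤ n) :
    Function.Surjective (augmentationMod p G hn) := fun c =>
  ⟨Submodule.Quotient.mk (algebraMap _ _ c), by
    rw [augmentationMod_mk, AlgHom.commutes, Algebra.algebraMap_self_apply]⟩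

end Augmentation

/-! ### Assembly of the exact sequence and the dimension formula -/

section MainTheorem

variable {p : ℕ} [Fact p.Prime] {F : Type u} [Group F] [TopologicalSpace F]
  {G : Type v} [Group G] [TopologicalSpace G] [IsProP p F] [IsProP p G] {d : ℕ} {σ : Fin d → F}
  {φ : F →ₜ* G} {r : ℕ → ℕ} {ρ : (Σ k : ℕ, Fin (r k)) → F}
  {f : (Σ k : ℕ, Fin (r k)) → CompletedGroupAlgebra (ZMod p) F}

omit [IsProP p F] in
theorem augIdeal_eq_span_mapCompleted_foxVar (hσ : TopGenerates fun j => φ (σ j)) :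
    augIdeal (ZMod p) G =
      Ideal.span (Set.range fun j => mapCompleted (ZMod p) φ (foxVar p σ j)) := by
  rw [augIdeal_eq_span p (mem_quotient_closure_of_topGenerates p hσ)]
  simp only [foxVar, map_sub, map_one, mapCompleted_ofGroup]

theorem range_truncatedJacobian (hφ : Function.Surjective φ)
    (hF : augIdeal (ZMod p) F = Ideal.span (Set.range (foxVar p σ)))
    (hfree : ∀ D : Fin d → CompletedGroupAlgebra (ZMod p) F, ∑ j, D j * foxVar p σ j = 0 → D = 0)
    (hG : augIdeal (ZMod p) G =
      Ideal.span (Set.range fun j => mapCompleted (ZMod p) φ (foxVar p σ j)))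
    (hρ : IsMinimalRelationSystem p φ.toMonoidHom.ker r ρ)
    (hf : ∀ a, f a = ofGroup (ZMod p) (ρ a) - 1) {n : ℕ} (hn : 1 ≤ n)
    (hdesc : ∀ a, RowDescends p φ σ (f a) n) :
    LinearMap.range (truncatedJacobian p φ σ f n) = LinearMap.ker (foxSum p σ φ n) := by
  have hfox : ∀ a, ∃! D : Fin d → CompletedGroupAlgebra (ZMod p) F,
      f a = ∑ j, D j * foxVar p σ j := fun a =>
    existsUnique_fox hF hfree (by rw [hf]; exact ofGroup_sub_one_mem _ _)
  have hφf : ∀ a, mapCompleted (ZMod p) φ (f a) = 0 := fun a => by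
    rw [hf, map_sub, map_one, mapCompleted_ofGroup, show φ (ρ a) = 1 from hρ.mem a, map_one,
      sub_self]
  apply le_antisymm
  · rw [LinearMap.range_le_ker_iff]
    refine DirectSum.linearMap_ext _ fun a => LinearMap.ext fun q => ?_
    obtain ⟨b, rfl⟩ := Submodule.Quotient.mk_surjective _ q
    have h := truncatedJacobian_of f (hdesc a) b
    exact (congrArg (foxSum p σ φ n) h).trans (foxSum_jacobianRowMod (hfox a) (hφf a) n b)
  · intro q hq
    refine mem_of_foxSum_eq_zero hφ hF hfree hG hρ hf hn _ (fun a => ?_) (LinearMap.mem_ker.1 hq)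
    exact ⟨_, truncatedJacobian_of f (hdesc a) 1⟩

-- Both sides are the image of I, which is generated by the φ(x_j).
omit [IsProP p F] [IsProP p G] in
theorem foxSum_exact (hG : augIdeal (ZMod p) G =
      Ideal.span (Set.range fun j => mapCompleted (ZMod p) φ (foxVar p σ j)))
    {n : ℕ} (hn : 1 ≤ n) :
    LinearMap.range ((foxSum p σ φ n).restrictScalars (ZMod p)) =
      LinearMap.ker (augmentationMod p G hn) := by
  ext q
  obtain ⟨b, rfl⟩ := Submodule.Quotient.mk_surjective _ q
  rw [LinearMap.mem_ker, augmentationMod_mk]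
  constructor
  · rintro ⟨g, hg⟩
    choose c hc using fun j => Submodule.Quotient.mk_surjective _ (g j)
    obtain rfl : (fun j => Submodule.Quotient.mk (c j)) = g := funext hc
    have h1 := (foxSum_mk (p := p) σ φ n c).symm.trans hg
    have h2 := congrArg (augmentationMod p G hn) h1
    rw [augmentationMod_mk, augmentationMod_mk] at h2
    rw [← h2, map_sum]
    refine Finset.sum_eq_zero fun j _ => ?_
    rw [map_mul, RingHom.mem_ker.1 (mapCompleted_foxVar_mem σ φ j), mul_zero]
  · intro hb
    have hb' : b ∈ augIdeal (ZMod p) G := hb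
    rw [hG] at hb'
    obtain ⟨B, rfl⟩ := mem_span_range_iff.1 hb'
    exact ⟨_, foxSum_mk (p := p) σ φ n B⟩

theorem cInv_zero (p : ℕ) [Fact p.Prime] (G : Type v) [Group G] [TopologicalSpace G] : cInv p G 0 = 0 := by
  have : Subsingleton (CompletedGroupAlgebra (ZMod p) G ⧸ augIdeal (ZMod p) G ^ 0) :=
    Submodule.Quotient.subsingleton_iff.2 (by rw [Submodule.pow_zero, Ideal.one_eq_top])
  exact Module.finrank_zero_of_subsingleton

/-- The convention r_0 = 1 accounts for the extra term c_n, coming from 𝔽_p[[G]]/I^n, and the term i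
= n vanishes because c_0 = 0. -/
theorem sum_relCount_mul (h0 : r 0 = 0) (c : ℕ → ℕ) (hc : c 0 = 0) (n : ℕ) :
    ∑ i ∈ Finset.range (n + 1), relCount r i * c (n - i) =
      (∑ k ∈ Finset.range n, r k * c (n - k)) + c n := by
  have h : ∀ i, relCount r i * c (n - i) = r i * c (n - i) + if i = 0 then c n else 0 := by
    intro i
    rw [relCount]
    split_ifs with hi
    · rw [hi, h0]; simp
    · rw [add_zero]
  simp only [h, Finset.sum_add_distrib, Finset.sum_ite_eq', Finset.mem_range, Nat.succ_pos,
    if_true]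
  rw [Finset.sum_range_succ, Nat.sub_self, hc, mul_zero, add_zero]

/-- The dimension formula for the truncated Jacobian. -/
theorem finite_jacobianKer_and_sum_eq (hφ : Function.Surjective φ)
    (hF : augIdeal (ZMod p) F = Ideal.span (Set.range (foxVar p σ)))
    (hfree : ∀ D : Fin d → CompletedGroupAlgebra (ZMod p) F, ∑ j, D j * foxVar p σ j = 0 → D = 0)
    (hG : augIdeal (ZMod p) G =
      Ideal.span (Set.range fun j => mapCompleted (ZMod p) φ (foxVar p σ j)))
    (hρ : IsMinimalRelationSystem p φ.toMonoidHom.ker r ρ)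
    (hf : ∀ a, f a = ofGroup (ZMod p) (ρ a) - 1) (hlevel : ∀ a, level p (f a) = a.1)
    {n : ℕ} (hn : 1 ≤ n) (hdesc : ∀ a, RowDescends p φ σ (f a) n) :
    Module.Finite (ZMod p) (jacobianKer p φ σ f n) ∧
      (∑ k ∈ Finset.range n, r k * cInv p G (n - k)) + cInv p G n =
        1 + eInv p φ σ f n + d * cInv p G (n - 1) := by
  have hfin := finite_quotient_augIdeal_pow hG
  obtain ⟨hfinA, hdimA⟩ := finrank_directSum_sigma (ZMod p) (r := r) n
    (fun a => CompletedGroupAlgebra (ZMod p) G ⧸ augIdeal (ZMod p) G ^ (n - level p (f a)))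
    (fun a ha => Submodule.Quotient.subsingleton_iff.2 (by
      rw [hlevel, Nat.sub_eq_zero_of_le ha, Submodule.pow_zero, Ideal.one_eq_top]))
    (fun k => cInv p G (n - k)) (fun a => by rw [hlevel]; rfl)
  have hJS := range_truncatedJacobian hφ hF hfree hG hρ hf hn hdesc
  obtain ⟨hfinJ, hcount⟩ := finite_and_finrank_ker_of_exact
    ((truncatedJacobian p φ σ f n).restrictScalars (ZMod p))
    ((foxSum p σ φ n).restrictScalars (ZMod p)) (augmentationMod p G hn)
    (congrArg (Submodule.restrictScalars (ZMod p)) hJS) (foxSum_exact hG hn)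
    (augmentationMod_surjective p G hn)
  rw [hdimA, Module.finrank_pi_fintype, Finset.sum_const, Finset.card_univ, Fintype.card_fin,
    smul_eq_mul] at hcount
  exact ⟨hfinJ, hcount⟩

end MainTheorem

end GolodShafarevich

theorem theorem2 (p : ℕ) [Fact p.Prime] (d : ℕ)
    {F : Type u} {G : Type v} [Group F] [TopologicalSpace F] [Group G] [TopologicalSpace G]
    [IsProP p F] [IsProP p G]
    (hF : ∃ τ : Fin d → F, IsFreeProPOn p τ)
    (φ : F →ₜ* G) (hφ : Function.Surjective φ)
    (σ : Fin d → F) (hσ : IsMinimalGenerating (fun j => φ (σ j)))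
    (r : ℕ → ℕ) (ρ : (Σ k : ℕ, Fin (r k)) → F)
    (hρ : IsMinimalRelationSystem p φ.toMonoidHom.ker r ρ)
    (f : (Σ k : ℕ, Fin (r k)) → CompletedGroupAlgebra (ZMod p) F)
    (hf : ∀ a, f a = ofGroup (ZMod p) (ρ a) - 1) :
    (∀ a, f a ∈ augIdeal (ZMod p) F ^ a.1 ∧ f a ∉ augIdeal (ZMod p) F ^ (a.1 + 1)) ∧
    (∀ a, ∃! D : Fin d → CompletedGroupAlgebra (ZMod p) F, f a = ∑ j, D j * foxVar p σ j) ∧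
    (∀ m : ℕ, Module.Finite (ZMod p)
      (CompletedGroupAlgebra (ZMod p) G ⧸ augIdeal (ZMod p) G ^ m)) ∧
    ∀ n : ℕ, 1 ≤ n →
      (∀ a, RowDescends p φ σ (f a) n) ∧
      Module.Finite (ZMod p) (jacobianKer p φ σ f n) ∧
      ∑ i ∈ Finset.range (n + 1), (relCount r i : ℤ) * (cInv p G (n - i) : ℤ)
        - (d : ℤ) * (cInv p G (n - 1) : ℤ) = 1 + (eInv p φ σ f n : ℤ) := by
  obtain ⟨τ, hτ⟩ := hF
  have hF := augIdeal_eq_span_of_isMinimalGenerating φ hτ hσ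
  -- The lifts σ need not be the given free basis τ; only the equality of their numbers is used to
  -- transfer freeness.
  have hfree := eq_zero_of_sum_mul_eq_zero_of_span hτ hF
  have hG := augIdeal_eq_span_mapCompleted_foxVar (p := p) hσ.1
  have hlevel : ∀ a, f a ∈ augIdeal (ZMod p) F ^ a.1 ∧ f a ∉ augIdeal (ZMod p) F ^ (a.1 + 1) :=
    fun a => by
      rw [hf]
      exact ⟨hρ.mem_zassenhaus a, hρ.notMem_zassenhaus a⟩
  have hfox : ∀ a, ∃! D : Fin d → CompletedGroupAlgebra (ZMod p) F,
      f a = ∑ j, D j * foxVar p σ j := fun a =>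
    existsUnique_fox hF hfree (by rw [hf]; exact ofGroup_sub_one_mem _ _)
  refine ⟨hlevel, hfox, finite_quotient_augIdeal_pow hG, fun n hn => ?_⟩
  have hv : ∀ a, level p (f a) = a.1 := fun a => level_eq (hlevel a).1 (hlevel a).2
  have hdesc : ∀ a, RowDescends p φ σ (f a) n := fun a =>
    rowDescends hF (hfox a) (hρ.one_le a) (hlevel a).1 (hv a) n
  obtain ⟨hfin, hcount⟩ :=
    finite_jacobianKer_and_sum_eq hφ hF hfree hG hρ hf hv hn hdesc
  refine ⟨hdesc, hfin, ?_⟩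
  rw [← sum_relCount_mul hρ.count_zero (cInv p G) (cInv_zero p G) n] at hcount
  have := congrArg (Nat.cast : ℕ → ℤ) hcount
  push_cast at this
  linarith
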